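/- Let $d\in\{1,2,3,4,7\}$. **Local data.** For a prime $p$ let $m_p(n)$ denote the exponent of $p$ in a nonzero integer $n$. Let $Q_d$ be the set of primes $p$ such that $m_p(n)$ is even for every nonzero integer $n$ of the form $x^2+dy^2$, $x,y\in\mathbb Z$, and put $R_1=R_2=R_4=\{2\}$, $R_3=\{3\}$, $R_7=\{2,7\}$. Call an element of $\mathbb Z/p^k\mathbb Z$ representable if it equals $x^2+dy^2$ for some $x,y\in\mathbb Z/p^k\mathbb Z$. For $p\in R_d$ and $h\ge 1$ let $$w_d(p)=\lim_{k\to\infty}\frac{\#\{a\in\mathbb Z/p^k\mathbb Z:\ a\text{ representable}\}}{p^k},\qquad W_{d,p}(h)=\lim_{k\to\infty}\frac{\#\{a\in\mathbb Z/p^k\mathbb Z:\ a\text{ and }a+h\text{ representable}\}}{p^k}.$$ **Constants.** Let $\delta_1=\delta_2=1$, $\delta_3=\tfrac23$, $\delta_4=\delta_7=\tfrac34$; $S_3=\tfrac34$ and $S_d=1$ for $d\ne 3$; and, with $\left(\frac{-d}{\cdot}\right)$ the Jacobi symbol and $\varphi$ Euler's function, $$g_d=\prod_{\substack{p\text{ odd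 prime}\\ \left(\frac{-d}{p}\right)=-1}}(1-p^{-2})^{-1/2},\qquad L_d(1)=\lim_{N\to\infty}\sum_{\substack{n<N\\ n\text{ odd}}}\left(\frac{-d}{n}\right)\frac1n,$$ $$\beta_d=\delta_d\,g_d\left(\frac{2d\,L_d(1)}{\pi\varphi(2d)}\right)^{1/2},\qquad c_d=\delta_d^2\,\frac{2d\,L_d(1)}{\pi\varphi(2d)}\,S_d\prod_{p\in R_d}\frac1{w_d(p)^2}.$$ **Singular series.** For $h\ge1$ let $$\mathscr T_{d,h}=c_d\prod_{p\in R_d}W_{d,p}(h)\prod_{\substack{p\in Q_d\\ p\mid h}}\frac{1-p^{-(m_p(h)+1)}}{1-p^{-1}}.$$ **Theorem.** All the limits, the series and the product above converge, and the singular series $\mathscr T_{d,h}$ has mean value $\beta_d$, that is $$\sum_{\substack{1\le d_1,d_2\le H\\ d_1\neq d_2}}\mathscr T_{d,|d_1-d_2|}\sim(\beta_dH)^2\qquad(H\to\infty,\ H\in\mathbb N).$$ More explicitly, for every $\varepsilon>0$, as $H\to\infty$ through the positive integers, $$\sum_{\substack{1\le d_1,d_2\le H\\ d_1\neq d_2}}\mathscr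 T_{d,|d_1-d_2|}=2\sum_{1\le h\le H-1}(H-h)\,\mathscr T_{d,h}=\beta_d^2H^2+O_\varepsilon\!\left(H^{1+\varepsilon}\right).$$ -/

import Mathlib

open Filter Topology Asymptotics
open scoped BigOperators

noncomputable section

namespace PairCorr

/-- The residues modulo `p ^ k` that are values of the form `x² + d y²` over `ℤ / p ^ k`. -/
def repMod (d p k : ℕ) : Set (ZMod (p ^ k)) :=
  {a | ∃ x y : ZMod (p ^ k), a = x ^ 2 + (d : ZMod (p ^ k)) * y ^ 2}

/-- Proportion of representable elements in `ℤ / p ^ k`. -/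
def densityMod (d p k : ℕ) : ℝ :=
  ((repMod d p k).ncard : ℝ) / (p : ℝ) ^ k

/-- Proportion of the `a` in `ℤ / p ^ k` for which `a` and `a + h` are both representable. -/
def pairDensityMod (d p h k : ℕ) : ℝ :=
  (({a : ZMod (p ^ k) | a ∈ repMod d p k ∧ a + (h : ZMod (p ^ k)) ∈ repMod d p k}).ncard : ℝ)
    / (p : ℝ) ^ k

/-- `w_d(p)`: the limiting density of representable elements in `ℤ / p ^ k`, `k → ∞`. -/
def w (d p : ℕ) : ℝ := limUnder atTop (densityMod d p)

/-- `W_{d,p}(h)`: the limiting density of representable pairs `(a, a + h)` in `ℤ / p ^ k`,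
`k → ∞`. -/
def W (d p h : ℕ) : ℝ := limUnder atTop (pairDensityMod d p h)

/-- `Q_d`: the primes that divide every nonzero value of `x² + d y²` to an even power. -/
def Q (d : ℕ) : Set ℕ :=
  {p | p.Prime ∧ ∀ x y : ℤ, x ^ 2 + (d : ℤ) * y ^ 2 ≠ 0 →
    Even (padicValInt p (x ^ 2 + (d : ℤ) * y ^ 2))}

/-- `R_d`: the finitely many exceptional primes for `d = 1, 2, 3, 4, 7`
(`p ∉ Q_d` and either `p` ramifies or representability imposes a further condition at `p`). -/
def R (d : ℕ) : Finset ℕ :=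
  if d = 3 then {3} else if d = 7 then {2, 7} else {2}

/-- The factors of `g_d`, indexed by the odd primes `p` with `(-d/p) = -1`. -/
def gFactor (d : ℕ) (p : {p : ℕ // p.Prime ∧ p ≠ 2 ∧ jacobiSym (-(d : ℤ)) p = -1}) : ℝ :=
  (1 - ((p : ℝ) ^ 2)⁻¹) ^ (-(1 / 2) : ℝ)

/-- `g_d = ∏_{(-d/p) = -1} (1 - p⁻²)^{-1/2}`, over odd primes `p`. -/
def g (d : ℕ) : ℝ := ∏' p, gFactor d p

/-- Partial sums of the series `L_d(1) = ∑_{n odd} (-d/n) n⁻¹` (Jacobi symbol). -/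
def LPartial (d N : ℕ) : ℝ :=
  ∑ n ∈ (Finset.range N).filter Odd, (jacobiSym (-(d : ℤ)) n : ℝ) / (n : ℝ)

/-- `L_d(1)`, the sum of a conditionally convergent series. -/
def L (d : ℕ) : ℝ := limUnder atTop (LPartial d)

/-- `δ_d`, equal to `1, 1, 2/3, 3/4, 3/4` for `d = 1, 2, 3, 4, 7`. -/
def δ (d : ℕ) : ℝ :=
  if d = 3 then 2 / 3 else if d = 4 ∨ d = 7 then 3 / 4 else 1

/-- `S_d`, equal to `3/4` for `d = 3` and to `1` for `d = 1, 2, 4, 7`. -/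
def S (d : ℕ) : ℝ := if d = 3 then 3 / 4 else 1

/-- The generalized Landau–Ramanujan constant `β_d` of the form `x² + d y²`. -/
def β (d : ℕ) : ℝ :=
  δ d * g d * √((L d * (2 * d)) / (Real.pi * (Nat.totient (2 * d) : ℝ)))

/-- The constant `c_d` in the singular series. -/
def c (d : ℕ) : ℝ :=
  δ d ^ 2 * ((L d * (2 * d)) / (Real.pi * (Nat.totient (2 * d) : ℝ))) *
    (∏ p ∈ R d, 1 / (w d p) ^ 2) * S d

open Classical in
/-- The pair-correlation singular series `𝒯_{d,h}` of the form `x² + d y²`, for `h ≥ 1`. -/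
def T (d h : ℕ) : ℝ :=
  c d * (∏ p ∈ R d, W d p h) *
    ∏ p ∈ h.primeFactors.filter (fun p => p ∈ Q d),
      (1 - ((p : ℝ) ^ (padicValNat p h + 1))⁻¹) / (1 - (p : ℝ)⁻¹)

end PairCorr

end

open Filter Topology Asymptotics
open scoped BigOperators

namespace PairCorr

/-! The mean value factors into local means. Apart from $c_d$, $\mathscr T_{d,h}$ is a product of
the functions $W_{d,p}(h)$, $p\in R_d$, and a product over $Q_d$ which expands as $\sum_{e\mid
h}1/e$ over the $e$ composed of primes of $Q_d$ (`prod_geom_eq_sum_divisors`). Since $R_d$ and $Q_d$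
are disjoint, these pieces are independent on average.

As $h$ runs through a full period modulo $p^K$, $(a,a+h)$ runs through all ordered pairs of
residues, so $W_{d,p}$ has mean $w_d(p)^2$ (`padicMean_W`). The divisor sum has mean $\sum
e^{-2}=\prod_{p\in Q_d}(1-p^{-2})^{-1}$, which is $g_d^2$ up to the factor at 2 that $S_d$ removes
(`S_mul_tsum`). With $c_d$ this gives $\beta_d^2$ (`c_mul_mean`).

For the error term, $W_{d,p}$ is not periodic, but by Hensel's lemma it is locally constant away
from $0$ on the scale of the valuation of $h$, and tends to $w_d(p)$ at a geometric rate as $h\to0$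
$p$-adically. Splitting by valuation therefore gives an error that is bounded uniformly over
progressions with modulus prime to $R_d$ (`HasProgMean.mul_padicLike`). Summing over the divisors
$e$ costs $\sum_{e\le x}1/e$, so the partial sums are $\beta_d^2x+O(1+\log x)$, and one further
summation gives the weighted sum. The asymptotic equivalence also needs $\beta_d\ne0$, hence
$L_d(1)>0$ (`L_pos`). -/

/-! ### Representability modulo prime powers and Hensel lifting -/

/-- The integer `a` is congruent to a value of `x² + d y²` modulo `p ^ k`. -/
def IsRep (d p k : ℕ) (a : ℤ) : Prop := (a : ZMod (p ^ k)) ∈ repMod d p k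

lemma isRep_iff {d p k : ℕ} {a : ℤ} :
    IsRep d p k a ↔ ∃ x y : ℤ, (p : ℤ) ^ k ∣ a - (x ^ 2 + d * y ^ 2) := by
  have key (x y : ℤ) : (p : ℤ) ^ k ∣ a - (x ^ 2 + d * y ^ 2) ↔
      (a : ZMod (p ^ k)) = (x : ZMod (p ^ k)) ^ 2 + (d : ZMod (p ^ k)) * (y : ZMod (p ^ k)) ^ 2 := by
    have h := ZMod.intCast_zmod_eq_zero_iff_dvd (a - (x ^ 2 + d * y ^ 2)) (p ^ k)
    push_cast at h
    rw [← h, sub_eq_zero]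
  simp only [key]
  constructor
  · rintro ⟨x, y, h⟩
    obtain ⟨x, rfl⟩ := ZMod.intCast_surjective x
    obtain ⟨y, rfl⟩ := ZMod.intCast_surjective y
    exact ⟨x, y, h⟩
  · rintro ⟨x, y, h⟩
    exact ⟨_, _, h⟩

lemma IsRep.mono {d p k l : ℕ} {a : ℤ} (h : IsRep d p l a) (hkl : k ≤ l) : IsRep d p k a := by
  rw [isRep_iff] at h ⊢
  obtain ⟨x, y, h⟩ := h
  exact ⟨x, y, (pow_dvd_pow _ hkl).trans h⟩

lemma IsRep.congr {d p k : ℕ} {a b : ℤ} (h : IsRep d p k a) (hab : (p : ℤ) ^ k ∣ a - b) :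
    IsRep d p k b := by
  rw [isRep_iff] at h ⊢
  obtain ⟨x, y, h⟩ := h
  refine ⟨x, y, ?_⟩
  have := dvd_sub h hab
  rwa [show a - (x ^ 2 + d * y ^ 2) - (a - b) = b - (x ^ 2 + d * y ^ 2) by ring] at this

lemma isRep_congr {d p k : ℕ} {a b : ℤ} (hab : (p : ℤ) ^ k ∣ a - b) :
    IsRep d p k a ↔ IsRep d p k b :=
  ⟨fun h => h.congr hab, fun h => h.congr ((dvd_sub_comm).1 hab)⟩

/-- Integers congruent to `1` modulo `p ^ 3` are squares modulo all powers of `p`. -/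
lemma exists_sq_congr {p : ℕ} (hp : p.Prime) {t : ℤ} (ht : (p : ℤ) ^ 3 ∣ t - 1) (k : ℕ) :
    ∃ s : ℤ, (p : ℤ) ^ k ∣ t - s ^ 2 := by
  have := Fact.mk hp
  have hp0 : (0 : ℝ) < p := by exact_mod_cast hp.pos
  -- Since $p^2\ge4>2$, the derivative $2$ of $X^2-t$ at $1$ loses at most one factor $p$. Hensel's
  -- condition $|1-t|<|2|^2$ thus follows from $p^3\mid t-1$ for every $p$, including $p=2$.
  have h2 : (p : ℝ) ^ (-1 : ℤ) ≤ ‖(2 : ℤ_[p])‖ := by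
    by_contra! hlt
    have h2' : ‖((2 : ℤ) : ℤ_[p])‖ ≤ (p : ℝ) ^ (-(2 : ℕ) : ℤ) := by
      rw [PadicInt.norm_le_pow_iff_norm_lt_pow_add_one]
      simpa using hlt
    rw [PadicInt.norm_int_le_pow_iff_dvd] at h2'
    have := Int.le_of_dvd (by norm_num) h2'
    have h3 : (2 : ℤ) ≤ p := by exact_mod_cast hp.two_le
    nlinarith
  have h1 : ‖(((t - 1 : ℤ)) : ℤ_[p])‖ ≤ (p : ℝ) ^ (-(3 : ℕ) : ℤ) := by
    rw [PadicInt.norm_int_le_pow_iff_dvd]; exact_mod_cast ht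
  have hlt : (p : ℝ) ^ (-(3 : ℕ) : ℤ) < ((p : ℝ) ^ (-1 : ℤ)) ^ 2 := by
    rw [← zpow_natCast, ← zpow_mul]
    exact zpow_lt_zpow_right₀ (by exact_mod_cast hp.one_lt) (by norm_num)
  let F : Polynomial ℤ_[p] := Polynomial.X ^ 2 - Polynomial.C (t : ℤ_[p])
  have hF : ‖F.aeval (1 : ℤ_[p])‖ < ‖F.derivative.aeval (1 : ℤ_[p])‖ ^ 2 := by
    have e1 : F.aeval (1 : ℤ_[p]) = -(((t - 1 : ℤ)) : ℤ_[p]) := by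
      simp [F]
    have e2 : F.derivative.aeval (1 : ℤ_[p]) = 2 := by
      simpa [F] using one_add_one_eq_two
    rw [e1, e2, norm_neg]
    refine h1.trans_lt (hlt.trans_le ?_)
    gcongr
  obtain ⟨z, hz, -⟩ := hensels_lemma hF
  have hz' : z ^ 2 = (t : ℤ_[p]) := by
    simpa [F, sub_eq_zero] using hz
  obtain ⟨s, hs⟩ := ZMod.intCast_surjective (PadicInt.toZModPow k z)
  refine ⟨s, ?_⟩
  have h := ZMod.intCast_zmod_eq_zero_iff_dvd (t - s ^ 2) (p ^ k)
  push_cast at h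
  rw [← h, hs, ← map_pow, hz', map_intCast, sub_self]

lemma isCoprime_of_sub_one {p : ℕ} {t : ℤ} (ht : (p : ℤ) ^ 3 ∣ t - 1) (k : ℕ) :
    IsCoprime t ((p : ℤ) ^ k) := by
  apply IsCoprime.pow_right
  obtain ⟨u, hu⟩ := (dvd_pow_self (p : ℤ) three_ne_zero).trans ht
  exact ⟨1, -u, by linear_combination hu⟩

/-- Modulo $p^k$ the factor $t$ is a square $s^2$, which can be absorbed into $x$ and $y$. -/
lemma IsRep.mul {d p k : ℕ} (hp : p.Prime) {a t : ℤ} (h : IsRep d p k a)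
    (ht : (p : ℤ) ^ 3 ∣ t - 1) : IsRep d p k (t * a) := by
  obtain ⟨s, hs⟩ := exists_sq_congr hp ht k
  rw [isRep_iff] at h ⊢
  obtain ⟨x, y, h⟩ := h
  refine ⟨s * x, s * y, ?_⟩
  obtain ⟨u, hu⟩ := hs
  obtain ⟨v, hv⟩ := h
  exact ⟨u * a + s ^ 2 * v, by linear_combination a * hu + s ^ 2 * hv⟩

/-- Two integers that are close `p`-adically, compared with their valuation, differ by a factor
congruent to `1` modulo `p ^ 3`, up to any given precision. -/
lemma exists_unit_factor {p : ℕ} (hp : p.Prime) {a b : ℤ} {m : ℕ} (hb : ¬ (p : ℤ) ^ (m + 1) ∣ b)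
    (hab : (p : ℤ) ^ (m + 3) ∣ a - b) (N : ℕ) :
    ∃ t : ℤ, (p : ℤ) ^ 3 ∣ t - 1 ∧ (p : ℤ) ^ N ∣ a - t * b := by
  have hb0 : b ≠ 0 := by rintro rfl; simp at hb
  have hp' : Prime (p : ℤ) := Nat.prime_iff_prime_int.1 hp
  obtain ⟨v, c, hc, rfl⟩ := WfDvdMonoid.max_power_factor hb0 hp'.irreducible
  have hvm : v ≤ m := by
    by_contra! h
    exact hb ((pow_dvd_pow _ h).mul_right c)
  have hva : (p : ℤ) ^ v ∣ a := by
    have h1 := (pow_dvd_pow (p : ℤ) (by omega : v ≤ m + 3)).trans hab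
    simpa using dvd_add h1 (dvd_mul_right ((p : ℤ) ^ v) c)
  obtain ⟨e, rfl⟩ := hva
  have hpv : (p : ℤ) ^ v ≠ 0 := pow_ne_zero _ hp'.ne_zero
  have hec : (p : ℤ) ^ 3 ∣ e - c := by
    have h1 := (pow_dvd_pow (p : ℤ) (by omega : v + 3 ≤ m + 3)).trans hab
    rw [pow_add, ← mul_sub] at h1
    exact (mul_dvd_mul_iff_left hpv).1 h1
  have hcop : IsCoprime c ((p : ℤ) ^ (N + 3)) :=
    ((hp'.coprime_iff_not_dvd).2 hc).symm.pow_right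
  obtain ⟨i, j, hij⟩ := hcop
  have hci : (p : ℤ) ^ (N + 3) ∣ i * c - 1 := ⟨-j, by linear_combination hij⟩
  -- Here $t=e/c$, with $i$ an inverse of $c$. Inverting modulo $p^{N+3}$ rather than $p^N$ secures
  -- $t\equiv1$ modulo $p^3$ even for small $N$.
  refine ⟨e * i, ?_, ?_⟩
  · have h1 := (pow_dvd_pow (p : ℤ) (by omega : 3 ≤ N + 3)).trans hci
    obtain ⟨u, hu⟩ := hec
    obtain ⟨v, hv⟩ := h1
    exact ⟨i * u + v, by linear_combination i * hu + hv⟩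
  · have h1 := (pow_dvd_pow (p : ℤ) (by omega : N ≤ N + 3)).trans hci
    obtain ⟨u, hu⟩ := h1
    exact ⟨-(p ^ v * e) * u, by linear_combination -(p ^ v * e) * hu⟩

/-- Representability modulo `p ^ k` lifts to all higher levels away from `0`. -/
lemma IsRep.lift {d p k : ℕ} (hp : p.Prime) {a : ℤ} (h : IsRep d p k a)
    (ha : ¬ (p : ℤ) ^ (k - 2) ∣ a) (l : ℕ) : IsRep d p l a := by
  -- For $k\le2$ the truncated difference $k-2$ is $0$, which contradicts `ha`. For $k=m+3$, $a$ is
  -- a unit square times the integer value $b$ of the form, at any precision.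
  obtain ⟨m, rfl⟩ : ∃ m, k = m + 3 := by
    refine ⟨k - 3, ?_⟩
    by_contra hk
    rw [show k - 2 = 0 by omega, pow_zero] at ha
    exact ha (one_dvd _)
  obtain ⟨x, y, h⟩ := isRep_iff.1 h
  set b : ℤ := x ^ 2 + d * y ^ 2 with hbdef
  have hb : ¬ (p : ℤ) ^ (m + 1) ∣ b := by
    intro hb
    apply ha
    have := (pow_dvd_pow (p : ℤ) (by omega : m + 1 ≤ m + 3)).trans h
    simpa using dvd_add this hb
  obtain ⟨t, ht, hat⟩ := exists_unit_factor hp hb h l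
  have hbrep : IsRep d p l b := isRep_iff.2 ⟨x, y, by simp [hbdef]⟩
  exact (hbrep.mul hp ht).congr ((dvd_sub_comm).1 hat)

/-! ### Counting residues and existence of the local densities -/

open Classical in
/-- The number of naturals below `n` that satisfy `X`. -/
noncomputable def cnt (n : ℕ) (X : ℕ → Prop) : ℕ := ((Finset.range n).filter X).card

lemma cnt_mono {n : ℕ} {X Y : ℕ → Prop} (h : ∀ a, X a → Y a) : cnt n X ≤ cnt n Y := by
  classical
  exact Finset.card_le_card (Finset.monotone_filter_right _ (fun a _ => h a))

lemma cnt_or_le (n : ℕ) (X Y : ℕ → Prop) : cnt n (fun a => X a ∨ Y a) ≤ cnt n X + cnt n Y := by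
  classical
  unfold cnt
  refine le_trans (Finset.card_le_card fun a ha => ?_) (Finset.card_union_le _ _)
  simp only [Finset.mem_union, Finset.mem_filter] at ha ⊢
  tauto

lemma cnt_eq_count (n : ℕ) (X : ℕ → Prop) [DecidablePred X] : cnt n X = Nat.count X n := by
  rw [Nat.count_eq_card_filter_range, cnt]
  congr!

lemma cnt_shift {n : ℕ} {X : ℕ → Prop} (hX : Function.Periodic X n) (h : ℕ) :
    cnt n (fun a => X (a + h)) = cnt n X := by
  classical
  rw [cnt_eq_count n X, ← Nat.filter_Ico_card_eq_of_periodic h n X hX]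
  unfold cnt
  refine Finset.card_bij (fun a _ => a + h) ?_ ?_ ?_
  · intro a ha
    simp only [Finset.mem_filter, Finset.mem_range, Finset.mem_Ico] at ha ⊢
    exact ⟨by omega, ha.2⟩
  · intro a _ b _ hab; simpa using hab
  · intro b hb
    simp only [Finset.mem_filter, Finset.mem_Ico] at hb
    refine ⟨b - h, ?_, by omega⟩
    simp only [Finset.mem_filter, Finset.mem_range]
    rw [Nat.sub_add_cancel hb.1.1]
    exact ⟨by omega, hb.2⟩

lemma cnt_mul {n : ℕ} {X : ℕ → Prop} (hX : Function.Periodic X n) (j : ℕ) :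
    cnt (n * j) X = j * cnt n X := by
  classical
  rw [cnt_eq_count, cnt_eq_count]
  induction j with
  | zero => simp
  | succ j ih =>
    rw [mul_add, mul_one, Nat.count_add, ih]
    have : (fun k => X (n * j + k)) = X := by
      funext k
      rw [add_comm, mul_comm]
      exact hX.nat_mul j k
    simp only [this]
    ring

lemma ncard_eq_cnt {n : ℕ} (hn : n ≠ 0) (Y : ZMod n → Prop) :
    {a : ZMod n | Y a}.ncard = cnt n (fun a => Y (a : ZMod n)) := by
  classical
  have : NeZero n := ⟨hn⟩
  unfold cnt
  rw [← Set.ncard_coe_finset]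
  symm
  refine Set.ncard_congr (fun a _ => (a : ZMod n)) ?_ ?_ ?_
  · intro a ha; simpa using (Finset.mem_filter.1 ha).2
  · intro a b ha hb hab
    have ha' := Finset.mem_range.1 (Finset.mem_filter.1 ha).1
    have hb' := Finset.mem_range.1 (Finset.mem_filter.1 hb).1
    have := (ZMod.natCast_eq_natCast_iff a b n).1 hab
    exact Nat.ModEq.eq_of_lt_of_lt this ha' hb'
  · intro b hb
    refine ⟨b.val, ?_, by simp⟩
    simp only [Finset.coe_filter, Finset.mem_range, Set.mem_ofPred_eq, ZMod.natCast_val,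
      ZMod.cast_id', id_eq]
    exact ⟨ZMod.val_lt b, hb⟩

lemma periodic_isRep (d p k l : ℕ) (hkl : k ≤ l) :
    Function.Periodic (fun a : ℕ => IsRep d p k a) (p ^ l) := by
  intro a
  simp only [eq_iff_iff]
  apply isRep_congr
  push_cast
  rw [add_sub_cancel_left]
  exact pow_dvd_pow _ hkl

/-- `a` and `a + h` are both representable modulo `p ^ k`. -/
def IsRepPair (d p k h a : ℕ) : Prop := IsRep d p k a ∧ IsRep d p k ((a + h : ℕ) : ℤ)

lemma periodic_isRepPair (d p k l h : ℕ) (hkl : k ≤ l) :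
    Function.Periodic (IsRepPair d p k h) (p ^ l) := by
  intro a
  have h1 := periodic_isRep d p k l hkl a
  have h2 := periodic_isRep d p k l hkl (a + h)
  simp only [eq_iff_iff] at h1 h2 ⊢
  unfold IsRepPair
  rw [h1, add_right_comm a (p ^ l) h, h2]

/-- Counting over the longer period $p^l$ puts different levels on a common footing for comparison.
-/
lemma densityMod_eq {d p k l : ℕ} (hp : p.Prime) (hkl : k ≤ l) :
    densityMod d p k = (cnt (p ^ l) (fun a => IsRep d p k a) : ℝ) / (p : ℝ) ^ l := by
  obtain ⟨j, rfl⟩ := Nat.exists_eq_add_of_le hkl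
  have hp0 : (p : ℝ) ≠ 0 := by exact_mod_cast hp.ne_zero
  rw [pow_add, cnt_mul (periodic_isRep d p k k le_rfl)]
  have : (repMod d p k).ncard = cnt (p ^ k) (fun a => IsRep d p k a) := by
    have := ncard_eq_cnt (pow_ne_zero k hp.ne_zero) (fun a => a ∈ repMod d p k)
    simpa [IsRep] using this
  rw [densityMod, this]
  push_cast
  field_simp
  ring

lemma pairDensityMod_eq {d p k l : ℕ} (h : ℕ) (hp : p.Prime) (hkl : k ≤ l) :
    pairDensityMod d p h k = (cnt (p ^ l) (IsRepPair d p k h) : ℝ) / (p : ℝ) ^ l := by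
  obtain ⟨j, rfl⟩ := Nat.exists_eq_add_of_le hkl
  have hp0 : (p : ℝ) ≠ 0 := by exact_mod_cast hp.ne_zero
  rw [pow_add, cnt_mul (periodic_isRepPair d p k k h le_rfl), pairDensityMod,
    ncard_eq_cnt (pow_ne_zero k hp.ne_zero)
      (fun a => a ∈ repMod d p k ∧ a + (h : ZMod (p ^ k)) ∈ repMod d p k)]
  have : (fun a : ℕ => (a : ZMod (p ^ k)) ∈ repMod d p k ∧
      (a : ZMod (p ^ k)) + (h : ZMod (p ^ k)) ∈ repMod d p k) = IsRepPair d p k h := by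
    funext a; simp [IsRepPair, IsRep]
  rw [this]
  push_cast
  field_simp
  ring

lemma densityMod_nonneg (d p k : ℕ) : 0 ≤ densityMod d p k := by
  unfold densityMod; positivity

lemma pairDensityMod_nonneg (d p h k : ℕ) : 0 ≤ pairDensityMod d p h k := by
  unfold pairDensityMod; positivity

lemma densityMod_antitone {p : ℕ} (d : ℕ) (hp : p.Prime) : Antitone (densityMod d p) := by
  intro k l hkl
  rw [densityMod_eq hp hkl, densityMod_eq hp le_rfl]
  gcongr
  exact cnt_mono fun a h => h.mono hkl

lemma pairDensityMod_antitone {p : ℕ} (d h : ℕ) (hp : p.Prime) :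
    Antitone (pairDensityMod d p h) := by
  intro k l hkl
  rw [pairDensityMod_eq h hp hkl, pairDensityMod_eq h hp le_rfl]
  gcongr
  exact cnt_mono fun a h => ⟨h.1.mono hkl, h.2.mono hkl⟩

/-- Representability at a higher level implies it at a lower one, so the proportions decrease and
are bounded below. -/
lemma tendsto_densityMod {p : ℕ} (d : ℕ) (hp : p.Prime) :
    Tendsto (densityMod d p) atTop (𝓝 (w d p)) := by
  have h := tendsto_atTop_ciInf (densityMod_antitone d hp)
    ⟨0, by rintro _ ⟨k, rfl⟩; exact densityMod_nonneg d p k⟩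
  rw [w, h.limUnder_eq]
  exact h

lemma tendsto_pairDensityMod {p : ℕ} (d h : ℕ) (hp : p.Prime) :
    Tendsto (pairDensityMod d p h) atTop (𝓝 (W d p h)) := by
  have h := tendsto_atTop_ciInf (pairDensityMod_antitone d h hp)
    ⟨0, by rintro _ ⟨k, rfl⟩; exact pairDensityMod_nonneg d p h k⟩
  rw [W, h.limUnder_eq]
  exact h

lemma cnt_dvd (p l j : ℕ) (hp : p.Prime) (hjl : j ≤ l) :
    cnt (p ^ l) (fun a => p ^ j ∣ a) = p ^ (l - j) := by
  obtain ⟨i, rfl⟩ := Nat.exists_eq_add_of_le hjl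
  have hper : Function.Periodic (fun a : ℕ => p ^ j ∣ a) (p ^ j) := by
    intro a; simp
  rw [pow_add, cnt_mul hper, Nat.add_sub_cancel_left]
  have : cnt (p ^ j) (fun a => p ^ j ∣ a) = 1 := by
    classical
    unfold cnt
    rw [Finset.card_eq_one]
    refine ⟨0, ?_⟩
    ext a
    simp only [Finset.mem_filter, Finset.mem_range, Finset.mem_singleton]
    constructor
    · rintro ⟨h1, h2⟩; exact Nat.eq_zero_of_dvd_of_lt h2 h1
    · rintro rfl; exact ⟨pow_pos hp.pos _, dvd_zero _⟩
  rw [this, mul_one]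

/-- By `IsRep.lift`, only residues divisible by $p^{k-2}$ can lose representability between levels
$k$ and $l$. -/
lemma densityMod_sub_le {p k l : ℕ} (d : ℕ) (hp : p.Prime) (hkl : k ≤ l) :
    densityMod d p k - densityMod d p l ≤ (p : ℝ) ^ 2 / (p : ℝ) ^ k := by
  have hp0 : (0 : ℝ) < p := by exact_mod_cast hp.pos
  have h1 : cnt (p ^ l) (fun a => IsRep d p k a) ≤
      cnt (p ^ l) (fun a => IsRep d p l a) + p ^ (l - (k - 2)) := by
    rw [← cnt_dvd p l (k - 2) hp (by omega)]
    refine le_trans (cnt_mono fun a h => ?_) (cnt_or_le _ _ _)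
    by_contra! hcon
    apply hcon.1
    apply h.lift hp
    intro hdvd
    exact hcon.2 (by exact_mod_cast hdvd)
  rw [densityMod_eq hp hkl, densityMod_eq hp le_rfl, ← sub_div]
  have h1' : (cnt (p ^ l) (fun a => IsRep d p k a) : ℝ) ≤
      cnt (p ^ l) (fun a => IsRep d p l a) + (p : ℝ) ^ (l - (k - 2)) := by exact_mod_cast h1
  rw [div_le_div_iff₀ (by positivity) (by positivity)]
  calc _ ≤ (p : ℝ) ^ (l - (k - 2)) * (p : ℝ) ^ k := by gcongr; linarith
    _ ≤ _ := by
      rw [← pow_add, ← pow_add]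
      exact pow_le_pow_right₀ (by exact_mod_cast hp.one_lt.le) (by omega)

/-- A pair is lost only if $a$ or $a+h$ is lost; by translation invariance both events have the same
count. -/
lemma pairDensityMod_sub_le {p k l : ℕ} (d h : ℕ) (hp : p.Prime) (hkl : k ≤ l) :
    pairDensityMod d p h k - pairDensityMod d p h l ≤
      2 * (densityMod d p k - densityMod d p l) := by
  classical
  have hp0 : (0 : ℝ) < p := by exact_mod_cast hp.pos
  set Z : ℕ → Prop := fun a => IsRep d p k a ∧ ¬ IsRep d p l a with hZ
  have hper : Function.Periodic Z (p ^ l) := by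
    intro a
    have h1 := periodic_isRep d p k l hkl a
    have h2 := periodic_isRep d p l l le_rfl a
    simp only [hZ, h1, h2]
  have hZc : cnt (p ^ l) Z + cnt (p ^ l) (fun a => IsRep d p l a) =
      cnt (p ^ l) (fun a => IsRep d p k a) := by
    unfold cnt
    rw [← Finset.card_filter_add_card_filter_not
      (s := (Finset.range (p ^ l)).filter (fun a : ℕ => IsRep d p k a))
      (fun a : ℕ => IsRep d p l a), Finset.filter_filter, Finset.filter_filter, add_comm]
    congr 2
    · apply Finset.filter_congr
      intro a _
      exact ⟨fun h => ⟨h.mono hkl, h⟩, fun h => h.2⟩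
    · congr!
  have h1 : cnt (p ^ l) (IsRepPair d p k h) ≤
      cnt (p ^ l) (IsRepPair d p l h) + (cnt (p ^ l) Z + cnt (p ^ l) Z) := by
    have hsh := cnt_shift hper h
    nth_rewrite 2 [← hsh]
    refine le_trans (cnt_mono fun a ha => ?_) ((cnt_or_le _ _ _).trans
      (Nat.add_le_add_left (cnt_or_le _ _ _) _))
    simp only [hZ, IsRepPair] at ha ⊢
    tauto
  rw [pairDensityMod_eq h hp hkl, pairDensityMod_eq h hp le_rfl, densityMod_eq hp hkl,
    densityMod_eq hp le_rfl, ← sub_div, ← sub_div, ← mul_div_assoc]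
  gcongr
  have h1' : (cnt (p ^ l) (IsRepPair d p k h) : ℝ) ≤
      cnt (p ^ l) (IsRepPair d p l h) + (cnt (p ^ l) Z + cnt (p ^ l) Z) := by exact_mod_cast h1
  have h2' : (cnt (p ^ l) Z : ℝ) + cnt (p ^ l) (fun a => IsRep d p l a) =
      cnt (p ^ l) (fun a => IsRep d p k a) := by exact_mod_cast hZc
  linarith

lemma w_le_densityMod {p : ℕ} (d : ℕ) (hp : p.Prime) (k : ℕ) : w d p ≤ densityMod d p k :=
  (densityMod_antitone d hp).le_of_tendsto (tendsto_densityMod d hp) k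

lemma W_le_pairDensityMod {p : ℕ} (d h : ℕ) (hp : p.Prime) (k : ℕ) :
    W d p h ≤ pairDensityMod d p h k :=
  (pairDensityMod_antitone d h hp).le_of_tendsto (tendsto_pairDensityMod d h hp) k

lemma densityMod_sub_w_le {p : ℕ} (d : ℕ) (hp : p.Prime) (k : ℕ) :
    densityMod d p k - w d p ≤ (p : ℝ) ^ 2 / (p : ℝ) ^ k :=
  le_of_tendsto ((tendsto_densityMod d hp).const_sub _)
    (eventually_atTop.2 ⟨k, fun _ hl => densityMod_sub_le d hp hl⟩)

lemma pairDensityMod_sub_W_le {p : ℕ} (d h : ℕ) (hp : p.Prime) (k : ℕ) :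
    pairDensityMod d p h k - W d p h ≤ 2 * (densityMod d p k - w d p) :=
  le_of_tendsto_of_tendsto ((tendsto_pairDensityMod d h hp).const_sub _)
    (((tendsto_densityMod d hp).const_sub _).const_mul 2)
    (eventually_atTop.2 ⟨k, fun _ hl => pairDensityMod_sub_le d h hp hl⟩)

/-- The class of $1$ modulo $p^3$ consists of squares at every level, so it contributes density
$p^{-3}$. -/
lemma w_pos {p : ℕ} (d : ℕ) (hp : p.Prime) : 0 < w d p := by
  have hp0 : (0 : ℝ) < p := by exact_mod_cast hp.pos
  have hle : 1 / (p : ℝ) ^ 3 ≤ w d p := by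
    refine ge_of_tendsto (tendsto_densityMod d hp) (eventually_atTop.2 ⟨3, fun l hl => ?_⟩)
    have hper : Function.Periodic (fun a : ℕ => p ^ 3 ∣ a) (p ^ l) := by
      intro a
      simp only [eq_iff_iff]
      exact (Nat.dvd_add_left (pow_dvd_pow p hl))
    have h1 : p ^ (l - 3) ≤ cnt (p ^ l) (fun a => IsRep d p l a) := by
      rw [← cnt_dvd p l 3 hp hl, ← cnt_shift (periodic_isRep d p l l le_rfl) 1]
      apply cnt_mono
      intro a ha
      obtain ⟨s, hs⟩ := exists_sq_congr (t := ((a + 1 : ℕ) : ℤ)) hp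
        (by push_cast; simpa using (by exact_mod_cast ha)) l
      exact isRep_iff.2 ⟨s, 0, by simpa using hs⟩
    have h1' : (p : ℝ) ^ (l - 3) ≤ cnt (p ^ l) (fun a => IsRep d p l a) := by exact_mod_cast h1
    rw [densityMod_eq hp le_rfl, div_le_div_iff₀ (by positivity) (by positivity), one_mul]
    calc (p : ℝ) ^ l = (p : ℝ) ^ (l - 3) * (p : ℝ) ^ 3 := by rw [← pow_add]; congr 1; omega
      _ ≤ _ := by gcongr
  exact lt_of_lt_of_le (by positivity) hle

/-! ### Dependence of `W` on `h` -/

/-- `W` is close to `w` at integers divisible by a high power of `p`. -/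
lemma abs_W_sub_w_le {p m h : ℕ} (d : ℕ) (hp : p.Prime) (hm : p ^ m ∣ h) :
    |W d p h - w d p| ≤ (p : ℝ) ^ 2 / (p : ℝ) ^ m := by
  -- At level $m$ the shift by $h$ is invisible, so the two densities agree exactly; the passage to
  -- the limit costs the error.
  have e : pairDensityMod d p h m = densityMod d p m := by
    rw [pairDensityMod_eq h hp le_rfl, densityMod_eq hp le_rfl]
    congr 3
    funext a
    simp only [IsRepPair, eq_iff_iff, and_iff_left_iff_imp]
    intro ha
    apply ha.congr
    push_cast
    rw [sub_add_cancel_left, dvd_neg]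
    exact_mod_cast hm
  have h1 := pairDensityMod_sub_W_le d h hp m
  have h2 := W_le_pairDensityMod d h hp m
  have h3 := densityMod_sub_w_le d hp m
  have h4 := w_le_densityMod d hp m
  rw [abs_le]
  constructor <;> linarith

/-- Write $h'\equiv th$ modulo $p^k$ with $t\equiv1$ modulo $p^3$. Multiplication by the unit $t$
preserves representability and injects the pairs $(a,a+h)$ into the pairs $(ta,ta+h')$. -/
lemma pairDensityMod_le_of_close {p m h h' : ℕ} (d : ℕ) (hp : p.Prime)
    (hm : ¬ p ^ (m + 1) ∣ h) (hh : h' ≡ h [MOD p ^ (m + 3)]) (k : ℕ) :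
    pairDensityMod d p h k ≤ pairDensityMod d p h' k := by
  have : NeZero (p ^ k) := ⟨pow_ne_zero k hp.ne_zero⟩
  have hd := (Nat.modEq_iff_dvd.1 hh.symm)
  push_cast at hd
  obtain ⟨t, ht, hat⟩ := exists_unit_factor hp (fun hdvd => hm (by exact_mod_cast hdvd)) hd k
  have hu : IsUnit (t : ZMod (p ^ k)) := by
    obtain ⟨i, j, hij⟩ := isCoprime_of_sub_one ht k
    refine IsUnit.of_mul_eq_one (i : ZMod (p ^ k)) ?_
    have h0 : ((p : ZMod (p ^ k)) ^ k) = 0 := by exact_mod_cast ZMod.natCast_self (p ^ k)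
    have := congrArg (Int.cast : ℤ → ZMod (p ^ k)) hij
    push_cast at this
    rw [h0, mul_zero, add_zero, mul_comm] at this
    exact this
  have hh' : (h' : ZMod (p ^ k)) = t * h := by
    have := ZMod.intCast_zmod_eq_zero_iff_dvd ((h' : ℤ) - t * h) (p ^ k)
    push_cast at this
    rw [← sub_eq_zero]
    exact this.2 hat
  have hmul : ∀ a ∈ repMod d p k, (t : ZMod (p ^ k)) * a ∈ repMod d p k := by
    intro a ha
    obtain ⟨b, rfl⟩ := ZMod.intCast_surjective a
    have := IsRep.mul (d := d) hp (a := b) ha ht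
    simpa [IsRep] using this
  unfold pairDensityMod
  refine div_le_div_of_nonneg_right (Nat.cast_le.2 ?_) (by positivity)
  refine Set.ncard_le_ncard_of_injOn (fun a => (t : ZMod (p ^ k)) * a) ?_
    (hu.mul_right_injective.injOn) (Set.toFinite _)
  rintro a ⟨h1, h2⟩
  refine ⟨hmul _ h1, ?_⟩
  rw [hh', ← mul_add]
  exact hmul _ h2

lemma W_eq_of_close {p m h h' : ℕ} (d : ℕ) (hp : p.Prime)
    (hm : ¬ p ^ (m + 1) ∣ h) (hh : h' ≡ h [MOD p ^ (m + 3)]) : W d p h' = W d p h := by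
  have hm' : ¬ p ^ (m + 1) ∣ h' := by
    intro hd
    apply hm
    have := hh.of_dvd (pow_dvd_pow p (by omega : m + 1 ≤ m + 3))
    exact (this.dvd_iff dvd_rfl).1 hd
  have : pairDensityMod d p h' = pairDensityMod d p h := by
    funext k
    exact le_antisymm (pairDensityMod_le_of_close d hp hm' hh.symm k)
      (pairDensityMod_le_of_close d hp hm hh k)
  rw [W, W, this]

/-! ### Mean values in progressions and decomposition into valuation shells -/

/-- The function `G` has mean value `M` along all arithmetic progressions whose modulus is coprime
to `N`, with a bounded error that is uniform in the progression. -/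
def HasProgMean (N : ℕ) (G : ℕ → ℝ) (M C : ℝ) : Prop :=
  ∀ q : ℕ, 0 < q → q.Coprime N → ∀ r x : ℕ,
    |∑ h ∈ (Finset.Ioc 0 x).filter (fun h => h ≡ r [MOD q]), G h - M * x / q| ≤ C

lemma hasProgMean_one : HasProgMean 1 (fun _ => 1) 1 1 := by
  intro q hq _ r x
  have hcount := Nat.Ioc_filter_modEq_card 0 x hq r
  have hq0 : (0 : ℚ) < q := by exact_mod_cast hq
  have hle : ⌊(((0 : ℕ) : ℚ) - r) / q⌋ ≤ ⌊((x : ℚ) - r) / q⌋ := by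
    apply Int.floor_le_floor
    gcongr
    simp
  rw [max_eq_left (by linarith)] at hcount
  have h1 := Int.floor_le (((x : ℚ) - r) / q)
  have h2 := Int.lt_floor_add_one (((x : ℚ) - r) / q)
  have h3 := Int.floor_le ((((0 : ℕ) : ℚ) - r) / q)
  have h4 := Int.lt_floor_add_one ((((0 : ℕ) : ℚ) - r) / q)
  have h5 : ((x : ℚ) - r) / q - (((0 : ℕ) : ℚ) - r) / q = x / q := by field_simp; push_cast; ring
  have hc : (((Finset.Ioc 0 x).filter (fun h => h ≡ r [MOD q])).card : ℚ) =
      ⌊((x : ℚ) - r) / q⌋ - ⌊(((0 : ℕ) : ℚ) - r) / q⌋ := by exact_mod_cast hcount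
  have key : |(((Finset.Ioc 0 x).filter (fun h => h ≡ r [MOD q])).card : ℚ) - x / q| ≤ 1 := by
    rw [abs_le]
    constructor <;> linarith
  rw [Finset.sum_const, nsmul_eq_mul, mul_one, one_mul]
  have key' := (Rat.cast_le (K := ℝ)).2 key
  push_cast at key'
  exact key'

/-- The residues modulo `p ^ (m + 3)` of exact `p`-adic valuation `m`. -/
def shell (p m : ℕ) : Finset ℕ :=
  (Finset.range (p ^ (m + 3))).filter (fun s => p ^ m ∣ s ∧ ¬ p ^ (m + 1) ∣ s)

lemma card_shell_le (p m : ℕ) (hp : p.Prime) : (shell p m).card ≤ p ^ 3 := by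
  have h := cnt_dvd p (m + 3) m hp (by omega)
  rw [Nat.add_sub_cancel_left] at h
  rw [← h]
  classical
  unfold cnt
  apply Finset.card_le_card
  intro s hs
  simp only [shell, Finset.mem_filter] at hs ⊢
  exact ⟨hs.1, hs.2.1⟩

/-- A function that is `p`-adically locally constant on the scale of the valuation and tends to `v`
at `0` at a rate `C p ^ (-m)`. -/
structure IsPadicLike (p : ℕ) (V : ℕ → ℝ) (v C : ℝ) : Prop where
  nonneg : 0 ≤ C
  congr : ∀ m h h', ¬ p ^ (m + 1) ∣ h → h' ≡ h [MOD p ^ (m + 3)] → V h' = V h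
  bound : ∀ m h, p ^ m ∣ h → |V h - v| ≤ C / (p : ℝ) ^ m

lemma isPadicLike_W {p : ℕ} (d : ℕ) (hp : p.Prime) :
    IsPadicLike p (W d p) (w d p) ((p : ℝ) ^ 2) where
  nonneg := by positivity
  congr _ _ _ h1 h2 := W_eq_of_close d hp h1 h2
  bound _ _ h := abs_W_sub_w_le d hp h

/-- Contribution of the integers of valuation `m` to the mean value of `V - v`. -/
noncomputable def shellMean (p : ℕ) (V : ℕ → ℝ) (v : ℝ) (m : ℕ) : ℝ :=
  ∑ s ∈ shell p m, (V s - v) / (p : ℝ) ^ (m + 3)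

lemma sum_shell_abs_le {p : ℕ} (hp : p.Prime) {V : ℕ → ℝ} {v C : ℝ} (hV : IsPadicLike p V v C)
    (m : ℕ) : ∑ s ∈ shell p m, |V s - v| ≤ (p : ℝ) ^ 3 * C * (1 / 2) ^ m := by
  have hC := hV.nonneg
  have h2 : (2 : ℝ) ≤ p := by exact_mod_cast hp.two_le
  calc ∑ s ∈ shell p m, |V s - v| ≤ ∑ s ∈ shell p m, C / (p : ℝ) ^ m := by
        apply Finset.sum_le_sum
        intro s hs
        exact hV.bound m s (Finset.mem_filter.1 hs).2.1
    _ = (shell p m).card * (C / (p : ℝ) ^ m) := by rw [Finset.sum_const, nsmul_eq_mul]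
    _ ≤ (p : ℝ) ^ 3 * (C / (2 : ℝ) ^ m) := by
        gcongr
        exact_mod_cast card_shell_le p m hp
    _ = _ := by rw [one_div_pow]; ring

lemma abs_shellMean_le {p : ℕ} (hp : p.Prime) {V : ℕ → ℝ} {v C : ℝ} (hV : IsPadicLike p V v C)
    (m : ℕ) : |shellMean p V v m| ≤ (p : ℝ) ^ 3 * C * (1 / 4) ^ m := by
  have hC := hV.nonneg
  have h2 : (2 : ℝ) ≤ p := by exact_mod_cast hp.two_le
  have hpow : (2 : ℝ) ^ m ≤ (p : ℝ) ^ (m + 3) :=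
    (pow_le_pow_left₀ (by norm_num) h2 m).trans
      (pow_le_pow_right₀ (by linarith) (by omega))
  calc |shellMean p V v m| ≤ ∑ s ∈ shell p m, |(V s - v) / (p : ℝ) ^ (m + 3)| :=
        Finset.abs_sum_le_sum_abs _ _
    _ = (∑ s ∈ shell p m, |V s - v|) / (p : ℝ) ^ (m + 3) := by
        rw [Finset.sum_div]
        refine Finset.sum_congr rfl fun s _ => ?_
        rw [abs_div, abs_of_pos (by positivity : (0 : ℝ) < (p : ℝ) ^ (m + 3))]
    _ ≤ ((p : ℝ) ^ 3 * C * (1 / 2) ^ m) / (2 : ℝ) ^ m := by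
        gcongr
        exact sum_shell_abs_le hp hV m
    _ = _ := by
        rw [show (1 / 4 : ℝ) = 1 / 2 * (1 / 2) by norm_num, mul_pow, one_div_pow]
        ring

/-- The mean value of a function as in `IsPadicLike`. -/
noncomputable def padicMean (p : ℕ) (V : ℕ → ℝ) (v : ℝ) : ℝ := v + ∑' m, shellMean p V v m

/-- Exactly one shell class contains $h$, at level $n=v_p(h)$, and `V` is constant on it. Truncation
at $K$ is harmless because $n<p^n\le h\le K$. -/
lemma eq_add_sum_shell {p : ℕ} (hp : p.Prime) {V : ℕ → ℝ} {v C : ℝ} (hV : IsPadicLike p V v C)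
    {h K : ℕ} (h0 : 0 < h) (hK : h ≤ K) :
    V h = v + ∑ m ∈ Finset.range K, ∑ s ∈ shell p m,
      if h ≡ s [MOD p ^ (m + 3)] then V s - v else 0 := by
  classical
  obtain ⟨n, hn, hn'⟩ : ∃ n, p ^ n ∣ h ∧ ¬ p ^ (n + 1) ∣ h :=
    ⟨padicValNat p h, pow_padicValNat_dvd, by
      have := Fact.mk hp
      exact pow_succ_padicValNat_not_dvd h0.ne'⟩
  have hnK : n < K := (n.lt_pow_self hp.one_lt).trans_le ((Nat.le_of_dvd h0 hn).trans hK)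
  have hpos (m : ℕ) : 0 < p ^ m := pow_pos hp.pos m
  set s₀ := h % p ^ (n + 3) with hs₀
  have hmod : s₀ ≡ h [MOD p ^ (n + 3)] := Nat.mod_modEq _ _
  have hs₀mem : s₀ ∈ shell p n := by
    simp only [shell, Finset.mem_filter, Finset.mem_range]
    refine ⟨Nat.mod_lt _ (hpos _), ?_, ?_⟩
    · exact ((hmod.of_dvd (pow_dvd_pow p (by omega))).dvd_iff dvd_rfl).2 hn
    · exact fun hd => hn' (((hmod.of_dvd (pow_dvd_pow p (by omega))).dvd_iff dvd_rfl).1 hd)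
  rw [Finset.sum_eq_single n, Finset.sum_eq_single s₀, if_pos hmod.symm,
    hV.congr n h s₀ hn' hmod]
  · ring
  · intro s hs hne
    rw [if_neg]
    intro hcon
    apply hne
    have h1 : s < p ^ (n + 3) := Finset.mem_range.1 (Finset.mem_filter.1 hs).1
    exact Nat.ModEq.eq_of_lt_of_lt (hcon.symm.trans hmod.symm) h1 (Nat.mod_lt _ (hpos _))
  · exact fun hcon => (hcon hs₀mem).elim
  · intro m _ hmn
    apply Finset.sum_eq_zero
    intro s hs
    rw [if_neg]
    intro hcon
    obtain ⟨-, h1, h2⟩ := Finset.mem_filter.1 hs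
    have h3 : p ^ m ∣ h := ((hcon.of_dvd (pow_dvd_pow p (by omega))).dvd_iff dvd_rfl).2 h1
    have h4 : ¬ p ^ (m + 1) ∣ h := fun hd =>
      h2 (((hcon.of_dvd (pow_dvd_pow p (by omega))).dvd_iff dvd_rfl).1 hd)
    rcases lt_or_gt_of_ne hmn with hlt | hlt
    · exact h4 ((pow_dvd_pow p hlt).trans hn)
    · exact hn' ((pow_dvd_pow p hlt).trans h3)
  · exact fun hcon => (hcon (Finset.mem_range.2 hnK)).elim

lemma summable_shellMean {p : ℕ} (hp : p.Prime) {V : ℕ → ℝ} {v C : ℝ}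
    (hV : IsPadicLike p V v C) : Summable (shellMean p V v) :=
  Summable.of_norm_bounded
    ((summable_geometric_of_lt_one (by norm_num) (by norm_num : (1 / 4 : ℝ) < 1)).mul_left _)
    (fun m => by simpa using abs_shellMean_le hp hV m)

lemma abs_tsum_shellMean_sub_le {p : ℕ} (hp : p.Prime) {V : ℕ → ℝ} {v C : ℝ}
    (hV : IsPadicLike p V v C) (K : ℕ) :
    |∑ m ∈ Finset.range K, shellMean p V v m - ∑' m, shellMean p V v m| ≤
      2 * ((p : ℝ) ^ 3 * C) * (1 / 4) ^ K := by
  have hs := summable_shellMean hp hV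
  have hg : Summable (fun m : ℕ => (p : ℝ) ^ 3 * C * (1 / 4) ^ (m + K)) := by
    simp only [pow_add, ← mul_assoc]
    exact ((summable_geometric_of_lt_one (by norm_num)
      (by norm_num : (1 / 4 : ℝ) < 1)).mul_left _).mul_right _
  have hC := hV.nonneg
  rw [← hs.sum_add_tsum_nat_add K, sub_add_cancel_left, abs_neg]
  calc ‖∑' m, shellMean p V v (m + K)‖ ≤ ∑' m : ℕ, (p : ℝ) ^ 3 * C * (1 / 4) ^ (m + K) :=
        tsum_of_norm_bounded hg.hasSum (fun m => abs_shellMean_le hp hV (m + K))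
    _ = (p : ℝ) ^ 3 * C * (1 / 4) ^ K * (4 / 3) := by
        simp only [pow_add, tsum_mul_left, tsum_mul_right,
          tsum_geometric_of_lt_one (by norm_num) (by norm_num : (1 / 4 : ℝ) < 1)]
        norm_num
        ring
    _ ≤ _ := by
        have : 0 ≤ (p : ℝ) ^ 3 * C * (1 / 4) ^ K := by positivity
        linarith

/-- By the Chinese remainder theorem, a shell class and a progression modulo $q$ merge into a
progression modulo $qp^{m+3}$, still coprime to $N$, where the error for `G` is at most $C$. The
weights $|V(s)-v|$ over a shell decay geometrically in $m$, so the accumulated error is bounded. -/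
lemma HasProgMean.mul_padicLike {N p : ℕ} {G V : ℕ → ℝ} {M C v D : ℝ} (hG : HasProgMean N G M C)
    (hp : p.Prime) (hV : IsPadicLike p V v D) (hpN : p.Coprime N) :
    ∃ C', HasProgMean (N * p) (fun h => V h * G h) (M * padicMean p V v) C' := by
  have hC : 0 ≤ C := (abs_nonneg _).trans (hG 1 one_pos (Nat.coprime_one_left N) 0 0)
  have hD := hV.nonneg
  set B : ℝ := (p : ℝ) ^ 3 * D with hB
  have hB0 : 0 ≤ B := by positivity
  refine ⟨|v| * C + C * (2 * B) + |M| * (2 * B), ?_⟩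
  intro q hq hqN r x
  have hq1 : (1 : ℝ) ≤ q := by exact_mod_cast hq
  have hqN' : q.Coprime N := hqN.coprime_dvd_right (dvd_mul_right N p)
  have hqp : q.Coprime p := hqN.coprime_dvd_right (dvd_mul_left p N)
  set A : ℕ → ℕ → ℝ := fun m s =>
    ∑ h ∈ (Finset.Ioc 0 x).filter (fun h => h ≡ r [MOD q] ∧ h ≡ s [MOD p ^ (m + 3)]), G h with hA
  set A0 : ℝ := ∑ h ∈ (Finset.Ioc 0 x).filter (fun h => h ≡ r [MOD q]), G h with hA0
  have hexp : ∑ h ∈ (Finset.Ioc 0 x).filter (fun h => h ≡ r [MOD q]), V h * G h =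
      v * A0 + ∑ m ∈ Finset.range x, ∑ s ∈ shell p m, (V s - v) * A m s := by
    have h1 : ∀ h ∈ (Finset.Ioc 0 x).filter (fun h => h ≡ r [MOD q]), V h * G h =
        v * G h + ∑ m ∈ Finset.range x, ∑ s ∈ shell p m,
          (V s - v) * (if h ≡ s [MOD p ^ (m + 3)] then G h else 0) := by
      intro h hh
      have hh' := Finset.mem_Ioc.1 (Finset.mem_filter.1 hh).1
      conv_lhs => rw [eq_add_sum_shell hp hV hh'.1 hh'.2, add_mul, Finset.sum_mul]
      congr 1
      refine Finset.sum_congr rfl fun m _ => ?_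
      rw [Finset.sum_mul]
      refine Finset.sum_congr rfl fun s _ => ?_
      split_ifs <;> simp
    rw [Finset.sum_congr rfl h1, Finset.sum_add_distrib, ← Finset.mul_sum, Finset.sum_comm]
    congr 1
    refine Finset.sum_congr rfl fun m _ => ?_
    rw [Finset.sum_comm]
    refine Finset.sum_congr rfl fun s _ => ?_
    rw [← Finset.mul_sum, hA]
    simp only
    rw [← Finset.filter_filter, Finset.sum_filter (fun h => h ≡ s [MOD p ^ (m + 3)])]
  have hAest (m s : ℕ) : |A m s - M * x / (q * (p : ℝ) ^ (m + 3))| ≤ C := by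
    have hcop : q.Coprime (p ^ (m + 3)) := hqp.pow_right _
    obtain ⟨k, hk1, hk2⟩ := Nat.chineseRemainder hcop r s
    have := hG (q * p ^ (m + 3)) (Nat.mul_pos hq (pow_pos hp.pos _))
      (Nat.Coprime.mul_left hqN' (hpN.pow_left _)) k x
    push_cast at this
    have hset : (Finset.Ioc 0 x).filter (fun h => h ≡ k [MOD q * p ^ (m + 3)]) =
        (Finset.Ioc 0 x).filter (fun h => h ≡ r [MOD q] ∧ h ≡ s [MOD p ^ (m + 3)]) := by
      apply Finset.filter_congr
      intro h _
      rw [← Nat.modEq_and_modEq_iff_modEq_mul hcop]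
      exact ⟨fun ⟨h1, h2⟩ => ⟨h1.trans hk1, h2.trans hk2⟩,
        fun ⟨h1, h2⟩ => ⟨h1.trans hk1.symm, h2.trans hk2.symm⟩⟩
    rwa [hset] at this
  have hA0est : |A0 - M * x / q| ≤ C := hG q hq hqN' r x
  -- The three errors are: the constant part $v$, the shell classes, and the tail $m\ge x$ of the
  -- mean series. The tail is $O(4^{-x})$, which beats the length $x$ of the range.
  have hsplit : v * A0 + ∑ m ∈ Finset.range x, ∑ s ∈ shell p m, (V s - v) * A m s -
      M * padicMean p V v * x / q =
      v * (A0 - M * x / q) +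
      ∑ m ∈ Finset.range x, ∑ s ∈ shell p m,
        (V s - v) * (A m s - M * x / (q * (p : ℝ) ^ (m + 3))) +
      (M * x / q) * (∑ m ∈ Finset.range x, shellMean p V v m - ∑' m, shellMean p V v m) := by
    have : (M * x / q) * ∑ m ∈ Finset.range x, shellMean p V v m =
        ∑ m ∈ Finset.range x, ∑ s ∈ shell p m,
          (V s - v) * (M * x / (q * (p : ℝ) ^ (m + 3))) := by
      rw [Finset.mul_sum]
      refine Finset.sum_congr rfl fun m _ => ?_
      rw [shellMean, Finset.mul_sum]
      refine Finset.sum_congr rfl fun s _ => ?_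
      rw [← div_div]
      ring
    rw [mul_sub (M * x / q), this, padicMean]
    simp only [mul_sub, Finset.sum_sub_distrib]
    ring
  rw [hexp, hsplit]
  refine (abs_add_le _ _).trans (add_le_add ((abs_add_le _ _).trans (add_le_add ?_ ?_)) ?_)
  · rw [abs_mul]
    gcongr
  · calc |∑ m ∈ Finset.range x, ∑ s ∈ shell p m,
          (V s - v) * (A m s - M * x / (q * (p : ℝ) ^ (m + 3)))|
        ≤ ∑ m ∈ Finset.range x, ∑ s ∈ shell p m,
          |(V s - v) * (A m s - M * x / (q * (p : ℝ) ^ (m + 3)))| :=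
          (Finset.abs_sum_le_sum_abs _ _).trans
            (Finset.sum_le_sum fun m _ => Finset.abs_sum_le_sum_abs _ _)
      _ ≤ ∑ m ∈ Finset.range x, C * (B * (1 / 2) ^ m) := by
          refine Finset.sum_le_sum fun m _ => ?_
          refine le_trans ?_ (mul_le_mul_of_nonneg_left (sum_shell_abs_le hp hV m) hC)
          rw [Finset.mul_sum]
          refine Finset.sum_le_sum fun s _ => ?_
          rw [abs_mul, mul_comm]
          gcongr
          exact hAest m s
      _ = C * (B * ∑ m ∈ Finset.range x, (1 / 2 : ℝ) ^ m) := by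
          rw [← Finset.mul_sum, ← Finset.mul_sum]
      _ ≤ C * (B * 2) := by
          gcongr
          exact sum_geometric_two_le x
      _ = C * (2 * B) := by ring
  · rw [abs_mul]
    have h1 : |M * x / q| ≤ |M| * x := by
      rw [abs_div, abs_mul, Nat.abs_cast, Nat.abs_cast]
      exact div_le_self (by positivity) hq1
    have h2 := abs_tsum_shellMean_sub_le hp hV x
    have h3 : (x : ℝ) * (1 / 4) ^ x ≤ 1 := by
      rw [one_div_pow, mul_one_div, div_le_one (by positivity)]
      have : x ≤ 4 ^ x := (Nat.lt_pow_self (by norm_num)).le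
      exact_mod_cast this
    calc _ ≤ |M| * x * (2 * B * (1 / 4) ^ x) := by gcongr
      _ = |M| * (2 * B) * (x * (1 / 4) ^ x) := by ring
      _ ≤ |M| * (2 * B) * 1 := by gcongr
      _ = _ := mul_one _

/-! ### The mean of `W` -/

/-- For fixed $a$, $a+h$ covers every residue once, so all ordered pairs of representable residues
are counted. -/
lemma sum_pairDensityMod {p : ℕ} (d K : ℕ) (hp : p.Prime) :
    ∑ h ∈ Finset.Ioc 0 (p ^ K), pairDensityMod d p h K = (p : ℝ) ^ K * densityMod d p K ^ 2 := by
  classical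
  have hp0 : (p : ℝ) ≠ 0 := by exact_mod_cast hp.ne_zero
  set n := p ^ K with hn
  have hper := periodic_isRep d p K K le_rfl
  have hcount : ∑ h ∈ Finset.Ioc 0 n, cnt n (IsRepPair d p K h) =
      cnt n (fun a => IsRep d p K a) ^ 2 := by
    unfold cnt
    simp only [Finset.card_filter]
    rw [Finset.sum_comm]
    have hinner : ∀ a ∈ Finset.range n,
        ∑ h ∈ Finset.Ioc 0 n, (if IsRepPair d p K h a then 1 else 0) =
        if IsRep d p K a then cnt n (fun a => IsRep d p K a) else 0 := by
      intro a _
      split_ifs with ha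
      · simp only [IsRepPair, ha, true_and]
        rw [← Finset.card_filter, cnt_eq_count n (fun a : ℕ => IsRep d p K a),
          ← Nat.filter_Ico_card_eq_of_periodic (a + 1) n _ hper]
        refine Finset.card_bij (fun h _ => a + h) ?_ ?_ ?_
        · intro h hh
          simp only [Finset.mem_filter, Finset.mem_Ioc, Finset.mem_Ico] at hh ⊢
          exact ⟨by omega, hh.2⟩
        · intro h _ h' _ hhh; simpa using hhh
        · intro b hb
          simp only [Finset.mem_filter, Finset.mem_Ico] at hb
          refine ⟨b - a, ?_, by omega⟩
          simp only [Finset.mem_filter, Finset.mem_Ioc]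
          rw [Nat.add_sub_cancel' (by omega)]
          exact ⟨by omega, hb.2⟩
      · simp [IsRepPair, ha]
    rw [Finset.sum_congr rfl hinner, ← Finset.sum_filter, Finset.sum_const, smul_eq_mul, sq]
    simp only [cnt, Finset.card_filter]
  rw [Finset.sum_congr rfl (fun h _ => pairDensityMod_eq h hp le_rfl), ← Finset.sum_div,
    densityMod_eq hp le_rfl, ← Nat.cast_sum, hcount]
  push_cast
  field_simp
  rw [hn]

/-- The mean value of `W` is the square of the density of representable elements. -/
lemma padicMean_W {p : ℕ} (d : ℕ) (hp : p.Prime) :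
    padicMean p (W d p) (w d p) = w d p ^ 2 := by
  obtain ⟨C, hC⟩ := hasProgMean_one.mul_padicLike hp (isPadicLike_W d hp) (Nat.coprime_one_right p)
  set μ := padicMean p (W d p) (w d p) with hμ
  have hp1 : (1 : ℝ) < p := by exact_mod_cast hp.one_lt
  have hp0 : (0 : ℝ) < p := by linarith
  -- The shell series is never evaluated: the average of $W$ over $1\le h\le p^K$ is compared with
  -- $\mu$ by the mean value estimate, and with the squared density by the exact identity at level
  -- $K$.
  have hbound (K : ℕ) :
      |densityMod d p K ^ 2 - μ| ≤ C / (p : ℝ) ^ K + 2 * (densityMod d p K - w d p) := by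
    have h1 := hC 1 one_pos (by simp) 0 (p ^ K)
    simp only [Nat.modEq_one, Finset.filter_true, mul_one, one_mul, Nat.cast_one, div_one,
      Nat.cast_pow] at h1
    have hpK : (0 : ℝ) < (p : ℝ) ^ K := by positivity
    have h2 : |∑ h ∈ Finset.Ioc 0 (p ^ K), pairDensityMod d p h K -
        ∑ h ∈ Finset.Ioc 0 (p ^ K), W d p h| ≤
        (p : ℝ) ^ K * (2 * (densityMod d p K - w d p)) := by
      rw [← Finset.sum_sub_distrib]
      calc _ ≤ ∑ h ∈ Finset.Ioc 0 (p ^ K), |pairDensityMod d p h K - W d p h| :=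
            Finset.abs_sum_le_sum_abs _ _
        _ ≤ ∑ h ∈ Finset.Ioc 0 (p ^ K), 2 * (densityMod d p K - w d p) := by
            refine Finset.sum_le_sum fun h _ => ?_
            rw [abs_of_nonneg (sub_nonneg.2 (W_le_pairDensityMod d h hp K))]
            exact pairDensityMod_sub_W_le d h hp K
        _ = _ := by simp
    rw [sum_pairDensityMod d K hp] at h2
    have h3 := abs_add_le ((p : ℝ) ^ K * densityMod d p K ^ 2 -
      ∑ h ∈ Finset.Ioc 0 (p ^ K), W d p h) (∑ h ∈ Finset.Ioc 0 (p ^ K), W d p h - μ * (p : ℝ) ^ K)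
    rw [sub_add_sub_cancel, mul_comm μ, ← mul_sub, abs_mul, abs_of_pos hpK] at h3
    rw [mul_comm ((p : ℝ) ^ K) μ] at h3
    rw [← mul_le_mul_iff_right₀ hpK, mul_add, mul_div_cancel₀ _ hpK.ne']
    linarith
  have hlim : Tendsto (fun K => C / (p : ℝ) ^ K + 2 * (densityMod d p K - w d p)) atTop (𝓝 0) := by
    have h1 : Tendsto (fun K : ℕ => C / (p : ℝ) ^ K) atTop (𝓝 0) :=
      tendsto_const_nhds.div_atTop (tendsto_pow_atTop_atTop_of_one_lt hp1)
    have h2 := ((tendsto_densityMod d hp).sub_const (w d p)).const_mul 2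
    simpa using h1.add h2
  have h1 : Tendsto (fun K => densityMod d p K ^ 2) atTop (𝓝 μ) := by
    rw [tendsto_iff_norm_sub_tendsto_zero]
    exact squeeze_zero (fun _ => norm_nonneg _) hbound hlim
  exact tendsto_nhds_unique h1 ((tendsto_densityMod d hp).pow 2)

lemma hasProgMean_prod_W (d : ℕ) (s : Finset ℕ) (hs : ∀ p ∈ s, p.Prime) :
    ∃ C, HasProgMean (∏ p ∈ s, p) (fun h => ∏ p ∈ s, W d p h) (∏ p ∈ s, w d p ^ 2) C := by
  classical
  induction s using Finset.induction_on with
  | empty => exact ⟨1, by simpa using hasProgMean_one⟩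
  | insert p s hps ih =>
    obtain ⟨C, hC⟩ := ih fun p hp => hs p (Finset.mem_insert_of_mem hp)
    have hp := hs p (Finset.mem_insert_self p s)
    have hcop : p.Coprime (∏ q ∈ s, q) := by
      apply Nat.Coprime.prod_right
      intro q hq
      exact (Nat.coprime_primes hp (hs q (Finset.mem_insert_of_mem hq))).2
        (fun h => hps (h ▸ hq))
    obtain ⟨C', hC'⟩ := hC.mul_padicLike hp (isPadicLike_W d hp) hcop
    refine ⟨C', ?_⟩
    simp only [Finset.prod_insert hps]
    rwa [padicMean_W d hp, mul_comm (∏ p ∈ s, w d p ^ 2), mul_comm (∏ p ∈ s, p)] at hC'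

/-! ### The divisor sum over numbers supported on a set of primes -/

/-- All prime factors of the nonzero number `n` belong to `A`. -/
def IsSupported (A : Set ℕ) (n : ℕ) : Prop := n ≠ 0 ∧ ∀ p, p.Prime → p ∣ n → p ∈ A

lemma isSupported_mul {A : Set ℕ} {m n : ℕ} :
    IsSupported A (m * n) ↔ IsSupported A m ∧ IsSupported A n := by
  constructor
  · rintro ⟨h0, h⟩
    exact ⟨⟨left_ne_zero_of_mul h0, fun p hp hd => h p hp (hd.mul_right n)⟩,
      ⟨right_ne_zero_of_mul h0, fun p hp hd => h p hp (hd.mul_left m)⟩⟩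
  · rintro ⟨⟨hm, h1⟩, ⟨hn, h2⟩⟩
    exact ⟨mul_ne_zero hm hn, fun p hp hd => (hp.dvd_mul.1 hd).elim (h1 p hp) (h2 p hp)⟩

lemma isSupported_prime {A : Set ℕ} {p : ℕ} (hp : p.Prime) : IsSupported A p ↔ p ∈ A := by
  constructor
  · exact fun h => h.2 p hp dvd_rfl
  · refine fun h => ⟨hp.ne_zero, fun q hq hd => ?_⟩
    rwa [(Nat.prime_dvd_prime_iff_eq hq hp).1 hd]

open Classical in
/-- The completely multiplicative function `n ↦ n ^ (-k)` restricted to the numbers supported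
on `A`. -/
noncomputable def invPow (A : Set ℕ) (k : ℕ) : ℕ →*₀ ℝ where
  toFun n := if IsSupported A n then ((n : ℝ) ^ k)⁻¹ else 0
  map_zero' := by simp [IsSupported]
  map_one' := by
    rw [if_pos ⟨one_ne_zero, fun p hp hd => (hp.one_lt.ne' (Nat.dvd_one.1 hd)).elim⟩]
    simp
  map_mul' m n := by
    by_cases hm : IsSupported A m <;> by_cases hn : IsSupported A n <;>
      simp [isSupported_mul, hm, hn, mul_pow, mul_comm]

lemma invPow_of {A : Set ℕ} {n : ℕ} (k : ℕ) (h : IsSupported A n) :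
    invPow A k n = ((n : ℝ) ^ k)⁻¹ := if_pos h

lemma invPow_of_not {A : Set ℕ} {n : ℕ} (k : ℕ) (h : ¬ IsSupported A n) :
    invPow A k n = 0 := if_neg h

lemma invPow_nonneg (A : Set ℕ) (k n : ℕ) : 0 ≤ invPow A k n := by
  by_cases h : IsSupported A n
  · rw [invPow_of k h]; positivity
  · rw [invPow_of_not k h]

lemma invPow_le (A : Set ℕ) (k n : ℕ) : invPow A k n ≤ ((n : ℝ) ^ k)⁻¹ := by
  by_cases h : IsSupported A n
  · rw [invPow_of k h]
  · rw [invPow_of_not k h]; positivity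

lemma summable_invPow_two (A : Set ℕ) : Summable (invPow A 2) :=
  Summable.of_nonneg_of_le (invPow_nonneg A 2) (invPow_le A 2)
    (Real.summable_nat_pow_inv.2 one_lt_two)

open ArithmeticFunction in
open scoped ArithmeticFunction.zeta in
/-- The local factors at the primes in `A` give a divisor sum. -/
lemma prod_geom_eq_sum_divisors (A : Set ℕ) [DecidablePred (· ∈ A)] {h : ℕ} (h0 : h ≠ 0) :
    ∏ p ∈ h.primeFactors.filter (fun p => p ∈ A),
      (1 - ((p : ℝ) ^ (padicValNat p h + 1))⁻¹) / (1 - (p : ℝ)⁻¹) =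
      ∑ e ∈ h.divisors, invPow A 1 e := by
  let a : ArithmeticFunction ℝ := ⟨invPow A 1, map_zero _⟩
  have ha : a.IsMultiplicative := ⟨map_one (invPow A 1), fun _ => map_mul (invPow A 1) _ _⟩
  -- The divisor sum is a Dirichlet convolution, so it suffices to compare at prime powers: a
  -- geometric sum for $p\in A$, and $1$ otherwise.
  have hF : (a * (ζ : ArithmeticFunction ℝ)).IsMultiplicative :=
    ha.mul isMultiplicative_zeta.natCast
  have e1 : ∑ e ∈ h.divisors, invPow A 1 e = (a * (ζ : ArithmeticFunction ℝ)) h := by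
    rw [coe_mul_zeta_apply]; rfl
  rw [e1, hF.multiplicative_factorization _ h0, Finset.prod_filter, Finsupp.prod,
    Nat.support_factorization]
  refine Finset.prod_congr rfl fun p hp => ?_
  have hpp := Nat.prime_of_mem_primeFactors hp
  have hp1 : (1 : ℝ) < p := by exact_mod_cast hpp.one_lt
  rw [coe_mul_zeta_apply, Nat.sum_divisors_prime_pow hpp, Nat.factorization_def _ hpp]
  have e2 : ∀ k, a (p ^ k) = invPow A 1 p ^ k := fun k => map_pow (invPow A 1) p k
  simp only [e2]
  split_ifs with hA
  · rw [invPow_of 1 ((isSupported_prime hpp).2 hA), pow_one, geom_sum_eq, ← inv_pow,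
      ← neg_sub ((p : ℝ)⁻¹ ^ _) 1, ← neg_sub ((p : ℝ)⁻¹) 1, neg_div_neg_eq]
    exact (inv_lt_one_of_one_lt₀ hp1).ne
  · rw [invPow_of_not 1 (fun h => hA ((isSupported_prime hpp).1 h))]
    simp

lemma abs_sum_invPow_sub_le (A : Set ℕ) (x : ℕ) :
    |∑ e ∈ Finset.Ioc 0 x, invPow A 2 e - ∑' n, invPow A 2 n| ≤ 2 / ((x : ℝ) + 1) := by
  have hs := (summable_invPow_two A).hasSum.tendsto_sum_nat
  have h1 : Tendsto (fun n => |∑ e ∈ Finset.Ioc 0 x, invPow A 2 e -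
      ∑ e ∈ Finset.range n, invPow A 2 e|) atTop
      (𝓝 |∑ e ∈ Finset.Ioc 0 x, invPow A 2 e - ∑' n, invPow A 2 n|) := (hs.const_sub _).abs
  refine le_of_tendsto h1 (eventually_atTop.2 ⟨x + 1, fun n hn => ?_⟩)
  have e1 : ∑ e ∈ Finset.range (x + 1), invPow A 2 e = ∑ e ∈ Finset.Ioc 0 x, invPow A 2 e := by
    rw [Finset.range_eq_Ico, Finset.sum_eq_sum_Ico_succ_bot (Nat.succ_pos x), map_zero, zero_add]
    rfl
  rw [← Finset.sum_range_add_sum_Ico _ hn, e1, sub_add_cancel_left, abs_neg,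
    abs_of_nonneg (Finset.sum_nonneg fun e _ => invPow_nonneg A 2 e)]
  exact (Finset.sum_le_sum fun e _ => invPow_le A 2 e).trans (sum_Ioo_inv_sq_le x n)

/-- Multiplication by a divisor sum supported on primes coprime to `N`. -/
lemma HasProgMean.sum_mul_divisorSum {N : ℕ} {G : ℕ → ℝ} {M C : ℝ} (hG : HasProgMean N G M C)
    {A : Set ℕ} (hA : ∀ p ∈ A, p.Coprime N) (x : ℕ) :
    |∑ h ∈ Finset.Ioc 0 x, G h * ∑ e ∈ h.divisors, invPow A 1 e -
      M * (∑' n, invPow A 2 n) * x| ≤ C * (1 + Real.log x) + 2 * |M| := by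
  have hC : 0 ≤ C := (abs_nonneg _).trans (hG 1 one_pos (Nat.coprime_one_left N) 0 0)
  set S : ℕ → ℝ := fun e => ∑ h ∈ (Finset.Ioc 0 x).filter (fun h => h ≡ 0 [MOD e]), G h with hS
  have e1 : ∑ h ∈ Finset.Ioc 0 x, G h * ∑ e ∈ h.divisors, invPow A 1 e =
      ∑ e ∈ Finset.Ioc 0 x, invPow A 1 e * S e := by
    simp only [hS, Finset.mul_sum, Finset.sum_filter]
    rw [Finset.sum_comm (s := Finset.Ioc 0 x) (t := Finset.Ioc 0 x)]
    refine Finset.sum_congr rfl fun h hh => ?_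
    obtain ⟨h1, h2⟩ := Finset.mem_Ioc.1 hh
    have : h.divisors = (Finset.Ioc 0 x).filter (fun e => h ≡ 0 [MOD e]) := by
      ext e
      simp only [Nat.mem_divisors, Finset.mem_filter, Finset.mem_Ioc, Nat.modEq_zero_iff_dvd]
      exact ⟨fun ⟨hd, _⟩ => ⟨⟨Nat.pos_of_dvd_of_pos hd h1, (Nat.le_of_dvd h1 hd).trans h2⟩, hd⟩,
        fun ⟨_, hd⟩ => ⟨hd, h1.ne'⟩⟩
    rw [this, Finset.sum_filter]
    refine Finset.sum_congr rfl fun e _ => ?_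
    split_ifs
    · ring
    · ring
  -- After interchanging the sums, $S(e)$ runs over the progression $0$ modulo $e$, whose modulus is
  -- coprime to $N$ whenever $e$ is supported on $A$. The weight $1/e$ turns $Mx/e+O(C)$ into
  -- $Mx/e^2+O(C/e)$.
  have hterm : ∀ e ∈ Finset.Ioc 0 x,
      |invPow A 1 e * S e - M * x * invPow A 2 e| ≤ C * (e : ℝ)⁻¹ := by
    intro e he
    have he0 : 0 < e := (Finset.mem_Ioc.1 he).1
    have he0' : (0 : ℝ) < e := by exact_mod_cast he0
    by_cases hs : IsSupported A e
    · have hcop : e.Coprime N := by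
        apply Nat.coprime_of_dvd
        intro p hp hpe hpN
        have := hA p (hs.2 p hp hpe)
        rw [hp.coprime_iff_not_dvd] at this
        exact this hpN
      have h1 := hG e he0 hcop 0 x
      rw [invPow_of 1 hs, invPow_of 2 hs, pow_one]
      have e2 : (e : ℝ)⁻¹ * S e - M * x * ((e : ℝ) ^ 2)⁻¹ = (e : ℝ)⁻¹ * (S e - M * x / e) := by
        rw [sq, mul_inv]; ring
      rw [e2, abs_mul, abs_of_pos (inv_pos.2 he0'), mul_comm]
      gcongr
    · rw [invPow_of_not 1 hs, invPow_of_not 2 hs]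
      simp only [zero_mul, mul_zero, sub_zero, abs_zero]
      positivity
  have e3 : ∑ e ∈ Finset.Ioc 0 x, invPow A 1 e * S e - M * (∑' n, invPow A 2 n) * x =
      ∑ e ∈ Finset.Ioc 0 x, (invPow A 1 e * S e - M * x * invPow A 2 e) +
      M * (x * (∑ e ∈ Finset.Ioc 0 x, invPow A 2 e - ∑' n, invPow A 2 n)) := by
    rw [Finset.sum_sub_distrib, ← Finset.mul_sum]
    ring
  rw [e1, e3]
  refine (abs_add_le _ _).trans (add_le_add ?_ ?_)
  · calc _ ≤ ∑ e ∈ Finset.Ioc 0 x, C * (e : ℝ)⁻¹ :=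
          (Finset.abs_sum_le_sum_abs _ _).trans (Finset.sum_le_sum hterm)
      _ = C * (harmonic x : ℝ) := by
          rw [← Finset.mul_sum, harmonic_eq_sum_Icc]
          push_cast
          rfl
      _ ≤ _ := by
          gcongr
          exact harmonic_le_one_add_log x
  · rw [abs_mul, abs_mul, Nat.abs_cast, mul_comm 2]
    gcongr
    calc (x : ℝ) * _ ≤ x * (2 / ((x : ℝ) + 1)) := by
          gcongr
          exact abs_sum_invPow_sub_le A x
      _ ≤ 2 := by
          rw [mul_div_assoc', div_le_iff₀ (by positivity)]
          linarith

/-! ### Determination of `Q d` -/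

/-- The odd primes `p` with `(-d/p) = -1`. -/
def inert (d : ℕ) : Set ℕ := {p | p.Prime ∧ p ≠ 2 ∧ jacobiSym (-(d : ℤ)) p = -1}

/-- Descent: a common factor $p$ of $x$ and $y$ removes $p^2$ from the value. The alternative of
valuation exactly $2$ serves $p=2$, $d=3$. -/
lemma even_padicValInt {p d : ℕ} (hp : p.Prime)
    (H : ∀ x y : ℤ, (p : ℤ) ∣ x ^ 2 + d * y ^ 2 →
      ((p : ℤ) ∣ x ∧ (p : ℤ) ∣ y) ∨ padicValInt p (x ^ 2 + d * y ^ 2) = 2)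
    (x y : ℤ) (h : x ^ 2 + (d : ℤ) * y ^ 2 ≠ 0) : Even (padicValInt p (x ^ 2 + d * y ^ 2)) := by
  have := Fact.mk hp
  induction hn : (x ^ 2 + (d : ℤ) * y ^ 2).natAbs using Nat.strong_induction_on
    generalizing x y with
  | _ n ih =>
    by_cases hdvd : (p : ℤ) ∣ x ^ 2 + d * y ^ 2
    · rcases H x y hdvd with ⟨⟨a, rfl⟩, ⟨b, rfl⟩⟩ | h2
      · have e : ((p : ℤ) * a) ^ 2 + d * (p * b) ^ 2 = ((p : ℤ) ^ 2) * (a ^ 2 + d * b ^ 2) := by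
          ring
        have hp0 : (p : ℤ) ≠ 0 := by exact_mod_cast hp.ne_zero
        rw [e] at h hn ⊢
        have h' := right_ne_zero_of_mul h
        have hlt : (a ^ 2 + (d : ℤ) * b ^ 2).natAbs < n := by
          rw [← hn, Int.natAbs_mul, Int.natAbs_pow, Int.natAbs_natCast]
          exact lt_mul_of_one_lt_left (Int.natAbs_pos.2 h') (Nat.one_lt_pow two_ne_zero hp.one_lt)
        have h2 := ih _ hlt a b h' rfl
        rw [padicValInt.mul (pow_ne_zero 2 hp0) h']
        have : padicValInt p ((p : ℤ) ^ 2) = 2 := by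
          rw [← Nat.cast_pow, padicValInt.of_nat, padicValNat.prime_pow]
        rw [this]
        exact even_two.add h2
      · rw [h2]; exact even_two
    · rw [padicValInt.eq_zero_of_not_dvd hdvd]
      exact Even.zero

lemma inert_subset_Q (d : ℕ) : inert d ⊆ Q d := by
  rintro p ⟨hp, hp2, hj⟩
  have := Fact.mk hp
  refine ⟨hp, even_padicValInt hp fun x y hd => Or.inl ?_⟩
  rw [← jacobiSym.legendreSym.to_jacobiSym] at hj
  exact legendreSym.prime_dvd_of_eq_neg_one hj (by simpa using hd)

lemma not_mem_Q_of_dvd_once {p d : ℕ} (hp : p.Prime) {x y : ℤ}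
    (h1 : (p : ℤ) ∣ x ^ 2 + d * y ^ 2) (h2 : ¬ (p : ℤ) ^ 2 ∣ x ^ 2 + d * y ^ 2) : p ∉ Q d := by
  rintro ⟨-, H⟩
  have := Fact.mk hp
  have h0 : x ^ 2 + (d : ℤ) * y ^ 2 ≠ 0 := by
    intro h; rw [h] at h2; exact h2 (dvd_zero _)
  have h := H x y h0
  have h3 : ¬ 2 ≤ padicValInt p (x ^ 2 + d * y ^ 2) := fun h' =>
    h2 ((padicValInt_dvd_iff 2 _).2 (Or.inr h'))
  have h4 : 1 ≤ padicValInt p (x ^ 2 + d * y ^ 2) :=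
    ((padicValInt_dvd_iff 1 _).1 (by simpa using h1)).resolve_left h0
  have h5 : padicValInt p (x ^ 2 + d * y ^ 2) = 1 := by omega
  rw [h5] at h
  exact Nat.not_even_one h

/-- Since $-d$ is a square modulo $p$, some $x^2+d$ is divisible by $p$. If it is divisible by
$p^2$, replacing $x$ by $x+p$ adds $p(2x+p)$, which is divisible by $p$ only once. -/
lemma not_mem_Q_of_jacobi {p d : ℕ} (hp : p.Prime) (hp2 : p ≠ 2) (hpd : ¬ p ∣ d)
    (hj : jacobiSym (-(d : ℤ)) p ≠ -1) : p ∉ Q d := by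
  have := Fact.mk hp
  have hpp := Nat.prime_iff_prime_int.1 hp
  have hpd' : ¬ (p : ℤ) ∣ d := by exact_mod_cast hpd
  have h0 : ((-(d : ℤ) : ℤ) : ZMod p) ≠ 0 := by
    rw [Ne, ZMod.intCast_zmod_eq_zero_iff_dvd, dvd_neg]
    exact hpd'
  rw [← jacobiSym.legendreSym.to_jacobiSym, Ne, legendreSym.eq_neg_one_iff, not_not] at hj
  obtain ⟨r, hr⟩ := hj
  obtain ⟨x, rfl⟩ := ZMod.intCast_surjective r
  have hx : (p : ℤ) ∣ x ^ 2 + d * 1 ^ 2 := by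
    have := ZMod.intCast_zmod_eq_zero_iff_dvd (x ^ 2 + d * 1 ^ 2) p
    rw [← this]
    push_cast at hr ⊢
    linear_combination -hr
  have hpx : ¬ (p : ℤ) ∣ x := by
    intro h
    apply hpd'
    have := dvd_sub hx (h.mul_right x)
    rwa [show x ^ 2 + (d : ℤ) * 1 ^ 2 - x * x = d by ring] at this
  by_cases h2 : (p : ℤ) ^ 2 ∣ x ^ 2 + d * 1 ^ 2
  · have e : (x + p) ^ 2 + (d : ℤ) * 1 ^ 2 = x ^ 2 + d * 1 ^ 2 + p * (2 * x + p) := by ring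
    refine not_mem_Q_of_dvd_once hp (x := x + p) (y := 1) ?_ ?_
    · rw [e]; exact dvd_add hx (dvd_mul_right _ _)
    · rw [e]
      intro h
      have h3 := (Int.dvd_add_right h2).1 h
      rw [sq, mul_dvd_mul_iff_left hpp.ne_zero] at h3
      have h4 := (Int.dvd_add_left (dvd_refl (p : ℤ))).1 h3
      rcases hpp.dvd_or_dvd h4 with h5 | h5
      · have : p ∣ 2 := by exact_mod_cast h5
        exact hp2 ((Nat.prime_dvd_prime_iff_eq hp Nat.prime_two).1 this)
      · exact hpx h5
  · exact not_mem_Q_of_dvd_once hp hx h2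

lemma two_mem_Q_three : 2 ∈ Q 3 := by
  refine ⟨Nat.prime_two, even_padicValInt Nat.prime_two fun x y hd => ?_⟩
  have := Fact.mk Nat.prime_two
  rcases Int.even_or_odd' x with ⟨a, rfl | rfl⟩ <;> rcases Int.even_or_odd' y with ⟨b, rfl | rfl⟩
  · exact Or.inl ⟨dvd_mul_right _ _, dvd_mul_right _ _⟩
  · push_cast at hd; ring_nf at hd; omega
  · push_cast at hd; ring_nf at hd; omega
  · right
    obtain ⟨u, hu⟩ := Int.even_mul_succ_self a
    obtain ⟨v, hv⟩ := Int.even_mul_succ_self b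
    -- Odd squares are $1$ modulo $8$, so for odd $x,y$ the value is $4$ times an odd number.
    have e : (2 * a + 1) ^ 2 + ((3 : ℕ) : ℤ) * (2 * b + 1) ^ 2 = 4 * (2 * (u + 3 * v) + 1) := by
      push_cast
      linear_combination 4 * hu + 12 * hv
    rw [e, padicValInt.mul (by norm_num) (by omega)]
    have h1 : padicValInt 2 4 = 2 := by
      rw [show (4 : ℤ) = ((2 ^ 2 : ℕ) : ℤ) by norm_num, padicValInt.of_nat, padicValNat.prime_pow]
    have h2 : padicValInt 2 (2 * (u + 3 * v) + 1) = 0 :=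
      padicValInt.eq_zero_of_not_dvd (by push_cast; omega)
    rw [h1, h2]

lemma two_not_mem_Q {d : ℕ} (hd : d = 1 ∨ d = 2 ∨ d = 4 ∨ d = 7) : 2 ∉ Q d := by
  have := Fact.mk Nat.prime_two
  have h8 : padicValInt 2 8 = 3 := by
    rw [show (8 : ℤ) = ((2 ^ 3 : ℕ) : ℤ) by norm_num, padicValInt.of_nat, padicValNat.prime_pow]
  rcases hd with rfl | rfl | rfl | rfl
  · exact not_mem_Q_of_dvd_once Nat.prime_two (x := 1) (y := 1) (by norm_num) (by norm_num)
  · exact not_mem_Q_of_dvd_once Nat.prime_two (x := 0) (y := 1) (by norm_num) (by norm_num)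
  -- For $d=4$ and $d=7$ no value has 2-adic valuation $1$; the value $8$ has valuation $3$.
  · rintro ⟨-, H⟩
    have h := H 2 1 (by norm_num)
    norm_num [h8] at h
  · rintro ⟨-, H⟩
    have h := H 1 1 (by norm_num)
    norm_num [h8] at h

lemma prime_dvd_four {p : ℕ} (hp : p.Prime) (h : p ∣ 4) : p = 2 :=
  (Nat.prime_dvd_prime_iff_eq hp Nat.prime_two).1 (hp.dvd_of_dvd_pow (n := 2) (by simpa using h))

lemma not_mem_Q_of_mem_R {d p : ℕ} (hd : d = 1 ∨ d = 2 ∨ d = 3 ∨ d = 4 ∨ d = 7) (hp : p ∈ R d) :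
    p ∉ Q d := by
  rcases hd with rfl | rfl | rfl | rfl | rfl <;> simp [R] at hp
  · subst hp; exact two_not_mem_Q (by simp)
  · subst hp; exact two_not_mem_Q (by simp)
  · subst hp
    exact not_mem_Q_of_dvd_once Nat.prime_three (x := 0) (y := 1) (by norm_num) (by norm_num)
  · subst hp; exact two_not_mem_Q (by simp)
  · rcases hp with rfl | rfl
    · exact two_not_mem_Q (by simp)
    · exact not_mem_Q_of_dvd_once (by norm_num) (x := 0) (y := 1) (by norm_num) (by norm_num)

/-- The symbol decides the odd primes not dividing $d$; the odd primes dividing $d$ lie in $R_d$ and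
are excluded. Only $2$ needs separate treatment. -/
lemma Q_eq {d : ℕ} (hd : d = 1 ∨ d = 2 ∨ d = 3 ∨ d = 4 ∨ d = 7) :
    Q d = if d = 3 then insert 2 (inert d) else inert d := by
  have key : ∀ p ∈ Q d, p ≠ 2 → p ∈ inert d := by
    intro p hp hp2
    refine ⟨hp.1, hp2, ?_⟩
    by_contra hj
    refine not_mem_Q_of_jacobi hp.1 hp2 (fun hpd => ?_) hj hp
    apply not_mem_Q_of_mem_R hd (p := p) _ hp
    rcases hd with rfl | rfl | rfl | rfl | rfl
    · exact (hp.1.one_lt.ne' (Nat.dvd_one.1 hpd)).elim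
    · exact (hp2 ((Nat.prime_dvd_prime_iff_eq hp.1 Nat.prime_two).1 hpd)).elim
    · simpa [R] using (Nat.prime_dvd_prime_iff_eq hp.1 Nat.prime_three).1 hpd
    · exact (hp2 (prime_dvd_four hp.1 hpd)).elim
    · have := (Nat.prime_dvd_prime_iff_eq hp.1 (by norm_num : Nat.Prime 7)).1 hpd
      simp [R, this]
  apply Set.Subset.antisymm
  · intro p hp
    split_ifs with h3
    · by_cases hp2 : p = 2
      · exact Set.mem_insert_iff.2 (Or.inl hp2)
      · exact Set.mem_insert_of_mem _ (key p hp hp2)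
    · refine key p hp ?_
      rintro rfl
      exact two_not_mem_Q (by omega) hp
  · split_ifs with h3
    · subst h3
      rintro p (rfl | hp)
      · exact two_mem_Q_three
      · exact inert_subset_Q 3 hp
    · exact inert_subset_Q d

lemma prime_of_mem_R {d p : ℕ} (hp : p ∈ R d) : p.Prime := by
  unfold R at hp
  split_ifs at hp <;> simp at hp
  · subst hp; norm_num
  · rcases hp with rfl | rfl <;> norm_num
  · subst hp; norm_num

lemma coprime_prod_R {d p : ℕ} (hd : d = 1 ∨ d = 2 ∨ d = 3 ∨ d = 4 ∨ d = 7) (hp : p ∈ Q d) :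
    p.Coprime (∏ q ∈ R d, q) := by
  apply Nat.Coprime.prod_right
  intro q hq
  rw [Nat.coprime_primes hp.1 (prime_of_mem_R hq)]
  rintro rfl
  exact not_mem_Q_of_mem_R hd hq hp

/-! ### Euler products and the constant `g` -/

lemma hasProd_invPow (A : Set ℕ) :
    HasProd (fun p : Nat.Primes => (1 - invPow A 2 p)⁻¹) (∑' n, invPow A 2 n) :=
  EulerProduct.eulerProduct_completely_multiplicative_hasProd (summable_invPow_two A).norm

lemma one_le_tsum_invPow (A : Set ℕ) : 1 ≤ ∑' n, invPow A 2 n := by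
  rw [← map_one (invPow A 2)]
  exact (summable_invPow_two A).le_tsum 1 (fun n _ => invPow_nonneg A 2 n)

/-- The square root of the Euler product over all primes, where the primes outside `inert d`
contribute $1$; the exponent $1/2$ passes to the limit by continuity. -/
lemma hasProd_gFactor (d : ℕ) :
    HasProd (gFactor d) ((∑' n, invPow (inert d) 2 n) ^ (1 / 2 : ℝ)) := by
  let i : {p : ℕ // p.Prime ∧ p ≠ 2 ∧ jacobiSym (-(d : ℤ)) p = -1} → Nat.Primes :=
    fun p => ⟨p, p.2.1⟩
  have hi : Function.Injective i := by
    intro p q h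
    exact Subtype.ext (congrArg (fun r : Nat.Primes => (r : ℕ)) h)
  have h := (hi.hasProd_iff (f := fun p : Nat.Primes => (1 - invPow (inert d) 2 p)⁻¹) (by
    intro p hp
    have : (p : ℕ) ∉ inert d := fun hmem => hp ⟨⟨p, hmem⟩, rfl⟩
    rw [invPow_of_not 2 (fun h => this ((isSupported_prime p.2).1 h))]
    simp)).2 (hasProd_invPow (inert d))
  have hZ := one_le_tsum_invPow (inert d)
  have h2 := Filter.Tendsto.rpow_const (p := (1 / 2 : ℝ)) h (Or.inl (by linarith))
  refine Tendsto.congr (fun s => ?_) h2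
  have hpos (p : {p : ℕ // p.Prime ∧ p ≠ 2 ∧ jacobiSym (-(d : ℤ)) p = -1}) :
      0 < 1 - ((p : ℝ) ^ 2)⁻¹ := by
    have hp1 : (1 : ℝ) < p := by exact_mod_cast p.2.1.one_lt
    exact sub_pos.2 (inv_lt_one_of_one_lt₀ (one_lt_pow₀ hp1 two_ne_zero))
  have e (p : {p : ℕ // p.Prime ∧ p ≠ 2 ∧ jacobiSym (-(d : ℤ)) p = -1}) :
      (1 - invPow (inert d) 2 (i p))⁻¹ = (1 - ((p : ℝ) ^ 2)⁻¹)⁻¹ := by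
    rw [invPow_of 2 ((isSupported_prime p.2.1).2 p.2)]
  simp only [Function.comp_apply, e]
  rw [← Real.finsetProd_rpow _ _ (fun p _ => (inv_pos.2 (hpos p)).le)]
  refine Finset.prod_congr rfl fun p _ => ?_
  rw [gFactor, Real.inv_rpow (hpos p).le, Real.rpow_neg (hpos p).le]

lemma g_sq (d : ℕ) : g d ^ 2 = ∑' n, invPow (inert d) 2 n := by
  have hZ := one_le_tsum_invPow (inert d)
  rw [g, (hasProd_gFactor d).tprod_eq, ← Real.sqrt_eq_rpow, Real.sq_sqrt (by linarith)]

lemma g_pos (d : ℕ) : 0 < g d := by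
  have hZ := one_le_tsum_invPow (inert d)
  rw [g, (hasProd_gFactor d).tprod_eq]
  exact Real.rpow_pos_of_pos (by linarith) _

lemma tsum_invPow_insert_two {A : Set ℕ} (hA : 2 ∉ A) :
    ∑' n, invPow (insert 2 A) 2 n = (∑' n, invPow A 2 n) * (4 / 3) := by
  classical
  let two : Nat.Primes := ⟨2, Nat.prime_two⟩
  have h1 := (hasProd_invPow A).mul
    (hasProd_ite_eq two (4 / 3 : ℝ))
  refine (hasProd_invPow (insert 2 A)).unique ?_
  convert h1 using 2 with p
  by_cases hp : p = two
  · subst hp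
    rw [if_pos rfl, invPow_of 2 ((isSupported_prime Nat.prime_two).2 (Set.mem_insert 2 A)),
      invPow_of_not 2 (fun h => hA ((isSupported_prime Nat.prime_two).1 h))]
    norm_num [two]
  · rw [if_neg hp, mul_one]
    have hp2 : (p : ℕ) ≠ 2 := fun h => hp (Subtype.ext h)
    by_cases hpA : (p : ℕ) ∈ A
    · rw [invPow_of 2 ((isSupported_prime p.2).2 hpA),
        invPow_of 2 ((isSupported_prime p.2).2 (Set.mem_insert_of_mem 2 hpA))]
    · rw [invPow_of_not 2 (fun h => hpA ((isSupported_prime p.2).1 h)),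
        invPow_of_not 2 (fun h => ((Set.mem_insert_iff.1 ((isSupported_prime p.2).1 h)).elim
          hp2 hpA))]

/-- The product $g_d$ omits the prime $2$, which belongs to $Q_3$; $S_3=3/4$ cancels its Euler
factor $(1-1/4)^{-1}$. -/
lemma S_mul_tsum {d : ℕ} (hd : d = 1 ∨ d = 2 ∨ d = 3 ∨ d = 4 ∨ d = 7) :
    S d * ∑' n, invPow (Q d) 2 n = g d ^ 2 := by
  rw [g_sq, Q_eq hd, S]
  split_ifs
  · rw [tsum_invPow_insert_two (fun h => h.2.1 rfl)]
    ring
  · rw [one_mul]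

/-! ### Convergence and positivity of `L d` -/

/-- The Jacobi symbol `(-d/n)` at odd `n`, extended by zero. -/
noncomputable def oddJacobi (d n : ℕ) : ℤ := if Odd n then jacobiSym (-(d : ℤ)) n else 0

lemma oddJacobi_periodic (d : ℕ) : Function.Periodic (oddJacobi d) (4 * d) := by
  intro n
  have hodd : Odd (n + 4 * d) ↔ Odd n := by
    rw [Nat.odd_add']
    simp [Nat.odd_mul, show ¬ Odd 4 by decide]
  unfold oddJacobi
  by_cases h : Odd n
  · rw [if_pos h, if_pos (hodd.2 h), jacobiSym.mod_right _ (hodd.2 h), jacobiSym.mod_right _ h]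
    simp
  · rw [if_neg h, if_neg (fun h' => h (hodd.1 h'))]

lemma sum_range_mul_add {q : ℕ} {f : ℕ → ℤ} (hf : Function.Periodic f q)
    (h0 : ∑ r ∈ Finset.range q, f r = 0) (k m : ℕ) :
    ∑ n ∈ Finset.range (q * k + m), f n = ∑ n ∈ Finset.range m, f n := by
  have hshift (k n : ℕ) : f (q * k + n) = f n := by
    rw [add_comm, mul_comm]
    exact hf.nat_mul k n
  have hk : ∑ n ∈ Finset.range (q * k), f n = 0 := by
    induction k with
    | zero => simp
    | succ k ih => rw [mul_add, mul_one, Finset.sum_range_add, ih, zero_add,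
        Finset.sum_congr rfl (fun n _ => hshift k n), h0]
  rw [Finset.sum_range_add, hk, zero_add, Finset.sum_congr rfl (fun n _ => hshift k n)]

lemma LPartial_eq (d N : ℕ) :
    LPartial d N = ∑ n ∈ Finset.range N, (oddJacobi d n : ℝ) / (n : ℝ) := by
  rw [LPartial, Finset.sum_filter]
  refine Finset.sum_congr rfl fun n _ => ?_
  unfold oddJacobi
  split_ifs <;> simp

lemma tendsto_LPartial_of_sum_eq_zero {d : ℕ} (hd : 0 < d)
    (h0 : ∑ r ∈ Finset.range (4 * d), oddJacobi d r = 0) :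
    Tendsto (LPartial d) atTop (𝓝 (L d)) := by
  -- Dirichlet's test. The weight $1/\max(n,1)$ stays antitone at $n=0$, where $1/n$ would be $0$;
  -- the coefficient there vanishes.
  have hanti : Antitone (fun n : ℕ => (1 : ℝ) / (max n 1 : ℕ)) := by
    intro m n hmn
    have : 0 < max m 1 := by simp
    simp only
    gcongr
  have hzero : Tendsto (fun n : ℕ => (1 : ℝ) / (max n 1 : ℕ)) atTop (𝓝 0) := by
    refine (tendsto_one_div_atTop_nhds_zero_nat (𝕜 := ℝ)).congr' ?_
    filter_upwards [eventually_ge_atTop 1] with n hn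
    rw [max_eq_left hn]
  have hbound : ∀ n : ℕ, ‖∑ i ∈ Finset.range n, (oddJacobi d i : ℝ)‖ ≤
      ((∑ i ∈ Finset.range (4 * d), |oddJacobi d i| : ℤ) : ℝ) := by
    intro n
    rw [← Nat.div_add_mod n (4 * d), ← Int.cast_sum,
      sum_range_mul_add (oddJacobi_periodic d) h0, Real.norm_eq_abs, ← Int.cast_abs]
    refine Int.cast_le.2 ((Finset.abs_sum_le_sum_abs _ _).trans ?_)
    refine Finset.sum_le_sum_of_subset_of_nonneg ?_ (fun _ _ _ => abs_nonneg _)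
    exact Finset.range_subset_range.2 (Nat.mod_lt _ (by omega)).le
  obtain ⟨l, hl⟩ := cauchySeq_tendsto_of_complete
    (hanti.cauchySeq_series_mul_of_tendsto_zero_of_bounded hzero hbound)
  have hl' : Tendsto (LPartial d) atTop (𝓝 l) := by
    refine hl.congr fun N => ?_
    rw [LPartial_eq]
    refine Finset.sum_congr rfl fun n _ => ?_
    rcases Nat.eq_zero_or_pos n with rfl | hn
    · simp [oddJacobi]
    · rw [max_eq_left hn, smul_eq_mul]
      ring
  rw [L, hl'.limUnder_eq]
  exact hl'

/-- Partial sums over whole periods increase from $0$, so the limit is at least the first block. -/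
lemma L_pos_of_block_pos {d : ℕ} (hd : 0 < d)
    (hL : Tendsto (LPartial d) atTop (𝓝 (L d)))
    (hblock : ∀ x : ℝ, 0 ≤ x → 0 < ∑ r ∈ Finset.range (4 * d), (oddJacobi d r : ℝ) / (x + r)) :
    0 < L d := by
  have hstep (k : ℕ) : LPartial d (4 * d * (k + 1)) = LPartial d (4 * d * k) +
      ∑ r ∈ Finset.range (4 * d), (oddJacobi d r : ℝ) / (((4 * d * k : ℕ) : ℝ) + r) := by
    rw [LPartial_eq, LPartial_eq, mul_add, mul_one, Finset.sum_range_add]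
    congr 1
    refine Finset.sum_congr rfl fun r _ => ?_
    have : oddJacobi d (4 * d * k + r) = oddJacobi d r := by
      rw [add_comm, mul_comm]
      exact (oddJacobi_periodic d).nat_mul k r
    rw [this, Nat.cast_add]
  have hmono : Monotone (fun k => LPartial d (4 * d * k)) := by
    refine monotone_nat_of_le_succ fun k => ?_
    rw [hstep]
    have := hblock ((4 * d * k : ℕ) : ℝ) (Nat.cast_nonneg _)
    linarith
  have hsub : Tendsto (fun k => LPartial d (4 * d * k)) atTop (𝓝 (L d)) :=
    hL.comp (tendsto_id.const_mul_atTop' (by omega : 0 < 4 * d))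
  refine lt_of_lt_of_le ?_ (hmono.ge_of_tendsto hsub 1)
  have h1 := hstep 0
  have h2 := hblock ((4 * d * 0 : ℕ) : ℝ) (Nat.cast_nonneg _)
  have h3 : LPartial d (4 * d * 0) = 0 := by simp [LPartial]
  rw [show (1 : ℕ) = 0 + 1 from rfl, h1, h3]
  linarith

lemma inv_lt_inv_add {x a b : ℝ} (hx : 0 ≤ x) (ha : 0 < a) (hab : a < b) :
    (x + b)⁻¹ < (x + a)⁻¹ :=
  inv_strictAnti₀ (by linarith) (by linarith)

/-- For $d=7$ the signs on a period of length 14 are antisymmetric about its centre $m$. Pairing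
$m\pm k$ gives $12/(m^2-36)-8/(m^2-16)-4/(m^2-4)$, and $12=8+4$. -/
lemma block_seven_pos {m : ℝ} (hm : 6 < m) :
    0 < (m - 6)⁻¹ - (m - 4)⁻¹ - (m - 2)⁻¹ + (m + 2)⁻¹ + (m + 4)⁻¹ - (m + 6)⁻¹ := by
  have e : (m - 6)⁻¹ - (m - 4)⁻¹ - (m - 2)⁻¹ + (m + 2)⁻¹ + (m + 4)⁻¹ - (m + 6)⁻¹ =
      8 * ((m ^ 2 - 36)⁻¹ - (m ^ 2 - 16)⁻¹) + 4 * ((m ^ 2 - 36)⁻¹ - (m ^ 2 - 4)⁻¹) := by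
    rw [show m ^ 2 - 36 = (m - 6) * (m + 6) by ring, show m ^ 2 - 16 = (m - 4) * (m + 4) by ring,
      show m ^ 2 - 4 = (m - 2) * (m + 2) by ring]
    have h1 : m - 6 ≠ 0 := by linarith
    have h2 : m - 4 ≠ 0 := by linarith
    have h3 : m - 2 ≠ 0 := by linarith
    have h4 : m + 6 ≠ 0 := by linarith
    have h5 : m + 4 ≠ 0 := by linarith
    have h6 : m + 2 ≠ 0 := by linarith
    field_simp
    ring
  have h36 : 0 < m ^ 2 - 36 := by nlinarith
  have h1 : (m ^ 2 - 16)⁻¹ < (m ^ 2 - 36)⁻¹ := inv_strictAnti₀ h36 (by linarith)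
  have h2 : (m ^ 2 - 4)⁻¹ < (m ^ 2 - 36)⁻¹ := inv_strictAnti₀ h36 (by linarith)
  rw [e]
  linarith

lemma sum_oddJacobi {d : ℕ} (hd : d = 1 ∨ d = 2 ∨ d = 3 ∨ d = 4 ∨ d = 7) :
    ∑ r ∈ Finset.range (4 * d), oddJacobi d r = 0 := by
  rcases hd with rfl | rfl | rfl | rfl | rfl <;>
    simp [Finset.sum_range_succ, oddJacobi, Nat.odd_iff] <;> norm_num

lemma block_pos {d : ℕ} (hd : d = 1 ∨ d = 2 ∨ d = 3 ∨ d = 4 ∨ d = 7) (x : ℝ) (hx : 0 ≤ x) :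
    0 < ∑ r ∈ Finset.range (4 * d), (oddJacobi d r : ℝ) / (x + r) := by
  have h {a b : ℝ} (ha : 0 < a) (hab : a < b) := inv_lt_inv_add hx ha hab
  rcases hd with rfl | rfl | rfl | rfl | rfl
  · have e : ∑ r ∈ Finset.range (4 * 1), (oddJacobi 1 r : ℝ) / (x + r) =
        (x + 1)⁻¹ - (x + 3)⁻¹ := by
      simp [Finset.sum_range_succ, oddJacobi, Nat.odd_iff]
      norm_num
      ring
    rw [e]
    linarith [h (a := 1) (b := 3) (by norm_num) (by norm_num)]
  · have e : ∑ r ∈ Finset.range (4 * 2), (oddJacobi 2 r : ℝ) / (x + r) =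
        (x + 1)⁻¹ + (x + 3)⁻¹ - (x + 5)⁻¹ - (x + 7)⁻¹ := by
      simp [Finset.sum_range_succ, oddJacobi, Nat.odd_iff]
      norm_num
      ring
    rw [e]
    linarith [h (a := 1) (b := 5) (by norm_num) (by norm_num),
      h (a := 3) (b := 7) (by norm_num) (by norm_num)]
  · have e : ∑ r ∈ Finset.range (4 * 3), (oddJacobi 3 r : ℝ) / (x + r) =
        (x + 1)⁻¹ - (x + 5)⁻¹ + (x + 7)⁻¹ - (x + 11)⁻¹ := by
      simp [Finset.sum_range_succ, oddJacobi, Nat.odd_iff]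
      norm_num
      ring
    rw [e]
    linarith [h (a := 1) (b := 5) (by norm_num) (by norm_num),
      h (a := 7) (b := 11) (by norm_num) (by norm_num)]
  · have e : ∑ r ∈ Finset.range (4 * 4), (oddJacobi 4 r : ℝ) / (x + r) =
        (x + 1)⁻¹ - (x + 3)⁻¹ + (x + 5)⁻¹ - (x + 7)⁻¹ +
          (x + 9)⁻¹ - (x + 11)⁻¹ + (x + 13)⁻¹ - (x + 15)⁻¹ := by
      simp [Finset.sum_range_succ, oddJacobi, Nat.odd_iff]
      norm_num
      ring
    rw [e]
    linarith [h (a := 1) (b := 3) (by norm_num) (by norm_num),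
      h (a := 5) (b := 7) (by norm_num) (by norm_num),
      h (a := 9) (b := 11) (by norm_num) (by norm_num),
      h (a := 13) (b := 15) (by norm_num) (by norm_num)]
  · have e : ∑ r ∈ Finset.range (4 * 7), (oddJacobi 7 r : ℝ) / (x + r) =
        ((x + 1)⁻¹ - (x + 3)⁻¹ - (x + 5)⁻¹ + (x + 9)⁻¹ + (x + 11)⁻¹ - (x + 13)⁻¹) +
        ((x + 15)⁻¹ - (x + 17)⁻¹ - (x + 19)⁻¹ + (x + 23)⁻¹ + (x + 25)⁻¹ - (x + 27)⁻¹) := by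
      simp [Finset.sum_range_succ, oddJacobi, Nat.odd_iff]
      norm_num
      ring
    rw [e]
    have h1 := block_seven_pos (m := x + 7) (by linarith)
    have h2 := block_seven_pos (m := x + 21) (by linarith)
    ring_nf at h1 h2 ⊢
    linarith

lemma tendsto_LPartial {d : ℕ} (hd : d = 1 ∨ d = 2 ∨ d = 3 ∨ d = 4 ∨ d = 7) :
    Tendsto (LPartial d) atTop (𝓝 (L d)) :=
  tendsto_LPartial_of_sum_eq_zero (by omega) (sum_oddJacobi hd)

lemma L_pos {d : ℕ} (hd : d = 1 ∨ d = 2 ∨ d = 3 ∨ d = 4 ∨ d = 7) : 0 < L d :=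
  L_pos_of_block_pos (by omega) (tendsto_LPartial hd) (block_pos hd)

/-! ### From ordered pairs to differences and partial sums -/

/-- A sum over ordered pairs of distinct integers in terms of their differences. -/
lemma sum_offDiag_eq (F : ℕ → ℝ) (H : ℕ) :
    ∑ q ∈ (Finset.Icc 1 H).offDiag, F ((q.1 : ℤ) - (q.2 : ℤ)).natAbs =
      2 * ∑ h ∈ Finset.Ico 1 H, ((H : ℝ) - (h : ℝ)) * F h := by
  induction H with
  | zero => simp
  | succ H ih =>
    have hnot : H + 1 ∉ Finset.Icc 1 H := by simp
    have hins : Finset.Icc 1 (H + 1) = insert (H + 1) (Finset.Icc 1 H) := by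
      ext a; simp only [Finset.mem_Icc, Finset.mem_insert]; omega
    have hedge : ∑ a ∈ Finset.Icc 1 H, F (((H + 1 : ℕ) : ℤ) - (a : ℤ)).natAbs =
        ∑ h ∈ Finset.Ico 1 (H + 1), F h := by
      refine Finset.sum_bij (fun a _ => H + 1 - a) ?_ ?_ ?_ ?_
      · intro a ha; simp only [Finset.mem_Icc, Finset.mem_Ico] at ha ⊢; omega
      · intro a ha b hb hab; simp only [Finset.mem_Icc] at ha hb hab; omega
      · intro b hb
        simp only [Finset.mem_Ico] at hb
        exact ⟨H + 1 - b, by simp only [Finset.mem_Icc]; omega, by omega⟩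
      · intro a ha
        simp only [Finset.mem_Icc] at ha
        congr 1
        omega
    have hedge' : ∑ a ∈ Finset.Icc 1 H, F ((a : ℤ) - ((H + 1 : ℕ) : ℤ)).natAbs =
        ∑ h ∈ Finset.Ico 1 (H + 1), F h := by
      rw [← hedge]
      refine Finset.sum_congr rfl fun a _ => ?_
      rw [← Int.natAbs_neg, neg_sub]
    have hright : ∑ h ∈ Finset.Ico 1 (H + 1), (((H + 1 : ℕ) : ℝ) - (h : ℝ)) * F h =
        ∑ h ∈ Finset.Ico 1 H, ((H : ℝ) - (h : ℝ)) * F h + ∑ h ∈ Finset.Ico 1 (H + 1), F h := by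
      have h1 : ∑ h ∈ Finset.Ico 1 (H + 1), ((H : ℝ) - (h : ℝ)) * F h =
          ∑ h ∈ Finset.Ico 1 H, ((H : ℝ) - (h : ℝ)) * F h := by
        rcases Nat.eq_zero_or_pos H with rfl | hH
        · simp
        · rw [Finset.sum_Ico_succ_top hH]; simp
      rw [← h1, ← Finset.sum_add_distrib]
      refine Finset.sum_congr rfl fun h _ => ?_
      push_cast
      ring
    rw [hright, hins, Finset.offDiag_insert hnot, Finset.sum_union, Finset.sum_union, ih,
      Finset.sum_product, Finset.sum_product_right, Finset.sum_singleton, Finset.sum_singleton,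
      hedge, hedge']
    · ring
    · rw [Finset.disjoint_left]
      rintro ⟨a, b⟩ h1 h2
      simp only [Finset.mem_offDiag, Finset.mem_product, Finset.mem_singleton] at h1 h2
      exact hnot (h2.1 ▸ h1.1)
    · rw [Finset.disjoint_left]
      rintro ⟨a, b⟩ h1 h2
      simp only [Finset.mem_union, Finset.mem_offDiag, Finset.mem_product,
        Finset.mem_singleton] at h1 h2
      rcases h1 with h1 | h1
      · exact hnot (h2.2 ▸ h1.2.1)
      · exact hnot (h1.1 ▸ h2.1)

/-- Weighted sums as averages of partial sums. -/
lemma sum_weighted_eq (F : ℕ → ℝ) (H : ℕ) :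
    ∑ h ∈ Finset.Ico 1 H, ((H : ℝ) - (h : ℝ)) * F h =
      ∑ x ∈ Finset.range H, ∑ h ∈ Finset.Ioc 0 x, F h := by
  induction H with
  | zero => simp
  | succ H ih =>
    rw [Finset.sum_range_succ, ← ih]
    have h1 : ∑ h ∈ Finset.Ico 1 (H + 1), ((H : ℝ) - (h : ℝ)) * F h =
        ∑ h ∈ Finset.Ico 1 H, ((H : ℝ) - (h : ℝ)) * F h := by
      rcases Nat.eq_zero_or_pos H with rfl | hH
      · simp
      · rw [Finset.sum_Ico_succ_top hH]; simp
    have h2 : Finset.Ioc 0 H = Finset.Ico 1 (H + 1) := by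
      ext a; simp only [Finset.mem_Ioc, Finset.mem_Ico]; omega
    rw [← h1, h2, ← Finset.sum_add_distrib]
    refine Finset.sum_congr rfl fun h _ => ?_
    push_cast
    ring

/-! ### Assembly of the constants and error terms -/

lemma β_pos {d : ℕ} (hd : d = 1 ∨ d = 2 ∨ d = 3 ∨ d = 4 ∨ d = 7) : 0 < β d := by
  have h1 : 0 < δ d := by unfold δ; split_ifs <;> norm_num
  have h2 : 0 < d := by omega
  have h3 : 0 < Nat.totient (2 * d) := Nat.totient_pos.2 (by omega)
  have h4 := L_pos hd
  have h5 := g_pos d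
  have h6 := Real.pi_pos
  unfold β
  positivity

/-- The constant in the singular series is normalised to give mean value `β ^ 2`. -/
lemma c_mul_mean {d : ℕ} (hd : d = 1 ∨ d = 2 ∨ d = 3 ∨ d = 4 ∨ d = 7) :
    c d * ((∏ p ∈ R d, w d p ^ 2) * ∑' n, invPow (Q d) 2 n) = β d ^ 2 := by
  have hw : (∏ p ∈ R d, 1 / (w d p) ^ 2) * ∏ p ∈ R d, w d p ^ 2 = 1 := by
    rw [← Finset.prod_mul_distrib]
    refine Finset.prod_eq_one fun p hp => ?_
    have := (w_pos d (prime_of_mem_R hp)).ne'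
    field_simp
  have hL := L_pos hd
  have hpi := Real.pi_pos
  rw [β, mul_pow, mul_pow, Real.sq_sqrt (by positivity), ← S_mul_tsum hd, c]
  linear_combination (δ d ^ 2 * ((L d * (2 * d)) / (Real.pi * (Nat.totient (2 * d) : ℝ))) * S d *
    ∑' n, invPow (Q d) 2 n) * hw

lemma T_eq (d : ℕ) {h : ℕ} (h0 : h ≠ 0) :
    T d h = c d * ((∏ p ∈ R d, W d p h) * ∑ e ∈ h.divisors, invPow (Q d) 1 e) := by
  classical
  rw [T, ← prod_geom_eq_sum_divisors (Q d) h0, mul_assoc]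

lemma exists_sum_T_bound {d : ℕ} (hd : d = 1 ∨ d = 2 ∨ d = 3 ∨ d = 4 ∨ d = 7) :
    ∃ C : ℝ, 0 ≤ C ∧ ∀ x : ℕ,
      |∑ h ∈ Finset.Ioc 0 x, T d h - β d ^ 2 * x| ≤ C * (1 + Real.log x) := by
  obtain ⟨C, hC⟩ := hasProgMean_prod_W d (R d) (fun p hp => prime_of_mem_R hp)
  have hC0 : 0 ≤ C := (abs_nonneg _).trans (hC 1 one_pos (Nat.coprime_one_left _) 0 0)
  set M := ∏ p ∈ R d, w d p ^ 2 with hM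
  refine ⟨|c d| * (C + 2 * |M|), by positivity, fun x => ?_⟩
  have h1 := hC.sum_mul_divisorSum (fun p hp => coprime_prod_R hd hp) x
  have e : ∑ h ∈ Finset.Ioc 0 x, T d h - β d ^ 2 * x =
      c d * (∑ h ∈ Finset.Ioc 0 x, (∏ p ∈ R d, W d p h) * ∑ e ∈ h.divisors, invPow (Q d) 1 e -
        M * (∑' n, invPow (Q d) 2 n) * x) := by
    rw [← c_mul_mean hd, Finset.sum_congr rfl
      (fun h hh => T_eq d (Finset.mem_Ioc.1 hh).1.ne'), ← Finset.mul_sum]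
    ring
  rw [e, abs_mul, mul_assoc |c d|]
  refine mul_le_mul_of_nonneg_left (h1.trans ?_) (abs_nonneg _)
  -- This lets $1+\log x\ge1$ absorb $2|M|$; it holds at $x=0$ too, where `Real.log` is $0$.
  have hlog : 0 ≤ Real.log x := Real.log_natCast_nonneg x
  nlinarith [abs_nonneg M]

lemma exists_weighted_sum_T_bound {d : ℕ} (hd : d = 1 ∨ d = 2 ∨ d = 3 ∨ d = 4 ∨ d = 7) :
    ∃ C : ℝ, 0 ≤ C ∧ ∀ H : ℕ,
      |2 * ∑ h ∈ Finset.Ico 1 H, ((H : ℝ) - (h : ℝ)) * T d h - β d ^ 2 * (H : ℝ) ^ 2| ≤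
        C * (H * (1 + Real.log H)) := by
  obtain ⟨C, hC0, hC⟩ := exists_sum_T_bound hd
  refine ⟨2 * C + β d ^ 2, by positivity, fun H => ?_⟩
  have hsum : ∑ x ∈ Finset.range H, (x : ℝ) = (H : ℝ) * (H - 1) / 2 := by
    induction H with
    | zero => simp
    | succ n ih => rw [Finset.sum_range_succ, ih]; push_cast; ring
  -- Twice $\sum_{x<H}x$ is $H^2-H$; the deficit $\beta_d^2H$ joins the error.
  have e : 2 * ∑ h ∈ Finset.Ico 1 H, ((H : ℝ) - (h : ℝ)) * T d h - β d ^ 2 * (H : ℝ) ^ 2 =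
      2 * ∑ x ∈ Finset.range H, (∑ h ∈ Finset.Ioc 0 x, T d h - β d ^ 2 * x) - β d ^ 2 * H := by
    rw [sum_weighted_eq, Finset.sum_sub_distrib, ← Finset.mul_sum, hsum]
    ring
  have h1 : |∑ x ∈ Finset.range H, (∑ h ∈ Finset.Ioc 0 x, T d h - β d ^ 2 * x)| ≤
      H * (C * (1 + Real.log H)) := by
    calc _ ≤ ∑ x ∈ Finset.range H, |∑ h ∈ Finset.Ioc 0 x, T d h - β d ^ 2 * x| :=
          Finset.abs_sum_le_sum_abs _ _
      _ ≤ ∑ x ∈ Finset.range H, C * (1 + Real.log H) := by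
          refine Finset.sum_le_sum fun x hx => (hC x).trans ?_
          have hlog : Real.log x ≤ Real.log H := by
            rcases Nat.eq_zero_or_pos x with rfl | hx0
            · simpa using Real.log_natCast_nonneg H
            · exact Real.log_le_log (Nat.cast_pos.2 hx0) (Nat.cast_le.2 (Finset.mem_range.1 hx).le)
          exact mul_le_mul_of_nonneg_left (by linarith) hC0
      _ = _ := by simp
  have h2 : β d ^ 2 * H ≤ β d ^ 2 * (H * (1 + Real.log H)) := by
    gcongr
    have := mul_nonneg (Nat.cast_nonneg (α := ℝ) H) (Real.log_natCast_nonneg H)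
    linarith
  have h3 : |β d ^ 2 * (H : ℝ)| = β d ^ 2 * H := abs_of_nonneg (by positivity)
  rw [e]
  refine (abs_sub _ _).trans ?_
  rw [abs_mul, abs_two, h3]
  linarith

lemma weighted_sum_T_isBigO {d : ℕ} (hd : d = 1 ∨ d = 2 ∨ d = 3 ∨ d = 4 ∨ d = 7) {ε : ℝ}
    (hε : 0 < ε) :
    (fun H : ℕ => 2 * ∑ h ∈ Finset.Ico 1 H, ((H : ℝ) - (h : ℝ)) * T d h -
      β d ^ 2 * (H : ℝ) ^ 2) =O[atTop] (fun H : ℕ => (H : ℝ) ^ (1 + ε)) := by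
  obtain ⟨C, hC0, hC⟩ := exists_weighted_sum_T_bound hd
  refine IsBigO.of_bound (C * (1 + 1 / ε)) ?_
  filter_upwards [eventually_ge_atTop 1] with H hH
  have hH1 : (1 : ℝ) ≤ H := by exact_mod_cast hH
  have h1 : Real.log H ≤ (H : ℝ) ^ ε / ε := Real.log_le_rpow_div (by linarith) hε
  have h2 : 1 ≤ (H : ℝ) ^ ε := Real.one_le_rpow hH1 hε.le
  rw [Real.norm_eq_abs, Real.norm_of_nonneg (by positivity), Real.rpow_add (by linarith),
    Real.rpow_one]
  calc _ ≤ C * (H * (1 + Real.log H)) := hC H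
    _ ≤ C * (H * ((H : ℝ) ^ ε + (H : ℝ) ^ ε / ε)) := by gcongr
    _ = _ := by ring

end PairCorr

open PairCorr in
theorem mainTheorem4 (d : ℕ) (hd : d = 1 ∨ d = 2 ∨ d = 3 ∨ d = 4 ∨ d = 7) :
    -- the limits, the series and the product that define the constants converge
    ((∀ p ∈ PairCorr.R d,
        Tendsto (PairCorr.densityMod d p) atTop (𝓝 (PairCorr.w d p)) ∧
        ∀ h : ℕ, 1 ≤ h →
          Tendsto (PairCorr.pairDensityMod d p h) atTop (𝓝 (PairCorr.W d p h))) ∧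
      Tendsto (PairCorr.LPartial d) atTop (𝓝 (PairCorr.L d)) ∧
      Multipliable (PairCorr.gFactor d)) ∧
    -- the sum over pairs is a weighted sum over differences
    (∀ H : ℕ,
      ∑ q ∈ (Finset.Icc 1 H).offDiag, PairCorr.T d ((q.1 : ℤ) - (q.2 : ℤ)).natAbs =
        2 * ∑ h ∈ Finset.Ico 1 H, ((H : ℝ) - (h : ℝ)) * PairCorr.T d h) ∧
    -- mean value `β_d`
    (fun H : ℕ => ∑ q ∈ (Finset.Icc 1 H).offDiag, PairCorr.T d ((q.1 : ℤ) - (q.2 : ℤ)).natAbs)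
      ~[atTop] (fun H : ℕ => (PairCorr.β d * (H : ℝ)) ^ 2) ∧
    -- the explicit form with error term
    ∀ ε : ℝ, 0 < ε →
      (fun H : ℕ =>
          2 * ∑ h ∈ Finset.Ico 1 H, ((H : ℝ) - (h : ℝ)) * PairCorr.T d h -
            PairCorr.β d ^ 2 * (H : ℝ) ^ 2)
        =O[atTop] (fun H : ℕ => (H : ℝ) ^ (1 + ε)) := by
  refine ⟨⟨fun p hp => ⟨tendsto_densityMod d (prime_of_mem_R hp),
    fun h _ => tendsto_pairDensityMod d h (prime_of_mem_R hp)⟩, tendsto_LPartial hd,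
    (hasProd_gFactor d).multipliable⟩, sum_offDiag_eq (T d), ?_,
    fun ε hε => weighted_sum_T_isBigO hd hε⟩
  -- Any exponent $\varepsilon<1$ makes the error $o(H^2)$; `β_pos` then allows comparison with
  -- $(\beta_dH)^2$.
  have h1 := weighted_sum_T_isBigO hd (ε := 1 / 2) (by norm_num)
  have h2 : (fun H : ℕ => (H : ℝ) ^ (1 + 1 / 2 : ℝ)) =o[atTop] (fun H : ℕ => (H : ℝ) ^ (2 : ℝ)) := by
    refine isLittleO_of_tendsto' ?_ ?_
    · filter_upwards [eventually_gt_atTop 0] with H hH h0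
      exact absurd h0 (Real.rpow_pos_of_pos (Nat.cast_pos.2 hH) _).ne'
    · refine ((tendsto_rpow_neg_atTop (y := 1 / 2) (by norm_num)).comp
        tendsto_natCast_atTop_atTop).congr' ?_
      filter_upwards [eventually_gt_atTop 0] with H hH
      rw [← Real.rpow_sub (Nat.cast_pos.2 hH)]
      norm_num
  have h3 : (fun H : ℕ => (H : ℝ) ^ (2 : ℝ)) =O[atTop] (fun H : ℕ => (β d * (H : ℝ)) ^ 2) := by
    have hβ := β_pos hd
    refine IsBigO.of_bound (1 / β d ^ 2) (Eventually.of_forall fun H => le_of_eq ?_)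
    rw [Real.rpow_two, mul_pow, norm_mul, Real.norm_of_nonneg (sq_nonneg (β d)), ← mul_assoc,
      one_div_mul_cancel (by positivity), one_mul]
  rw [IsEquivalent]
  refine ((h1.trans_isLittleO h2).trans_isBigO h3).congr_left fun H => ?_
  rw [Pi.sub_apply, sum_offDiag_eq (T d) H, mul_pow]
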